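/- Let $\mathbb{T}^2=(\mathbb{R}/2\pi\mathbb{Z})^2$ and $\langle n\rangle=(1+|n|^2)^{1/2}$ for $n\in\mathbb{Z}^2$, where $|n|$ is the Euclidean length. For $s\in\mathbb{R}$ let $H^s(\mathbb{T}^2)$ be the space of all $u=\sum_{n\in\mathbb{Z}^2}\widehat u(n)e^{in\cdot x}$ with $\|u\|_{H^s}^2=\sum_n\langle n\rangle^{2s}|\widehat u(n)|^2<\infty$. For $s<0$ let $\mu$ be the massive Gaussian free field, i.e. the Borel probability measure on $H^s(\mathbb{T}^2)$ that is the law of $$u(x)=\sum_{n\in\mathbb{Z}^2}\frac{g_n}{\sqrt{1+|n|^2}}\,e^{in\cdot x},$$ where $(g_n)_{n\in\mathbb{Z}^2}$ are independent standard complex Gaussian random variables (the real and imaginary parts of $g_n$ are independent real Gaussians of mean $0$ and variance $\frac12$). For $N\in\mathbb{N}$ let $\mathbf{P}_N$ be the projection onto the frequencies $|n|\le N$, and let $$\sigma_N=\sum_{|n|\le N}\frac1{1+|n|^2}.$$ Let $H_k(x;\sigma)$ be the Hermite polynomials, $e^{tx-\frac12\sigma t^2}=\sum_{k\ge0}\frac{t^k}{k!}H_k(x;\sigma)$.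 For an integer $m\ge1$ and $u_N=\mathbf{P}_Nu$, the Wick ordered monomial $:\!|u_N|^{2(m-1)}u_N\!:$ is obtained by Wick ordering the real and imaginary parts separately, i.e. by replacing each monomial $(\operatorname{Re}u_N)^j(\operatorname{Im}u_N)^k$ by $H_j(\operatorname{Re}u_N;\frac{\sigma_N}2)\,H_k(\operatorname{Im}u_N;\frac{\sigma_N}2)$: $$:\!|u_N|^{2(m-1)}u_N\!:\;=\sum_{\ell=0}^{m-1}\binom{m-1}{\ell}\Big[H_{2\ell+1}(\operatorname{Re}u_N;\tfrac{\sigma_N}2)H_{2(m-1-\ell)}(\operatorname{Im}u_N;\tfrac{\sigma_N}2)+i\,H_{2\ell}(\operatorname{Re}u_N;\tfrac{\sigma_N}2)H_{2(m-1-\ell)+1}(\operatorname{Im}u_N;\tfrac{\sigma_N}2)\Big].$$ Set $F_N(u)=\mathbf{P}_N\big(:\!|\mathbf{P}_Nu|^{2(m-1)}\mathbf{P}_Nu\!:\big)$. **Proposition 1.3.** Let $m\ge2$ be an integer and $s<0$. Then $\{F_N(u)\}_{N\in\mathbb{N}}$ is a Cauchy sequence in $L^p(\mu;H^s(\mathbb{T}^2))$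 for every finite $p\ge1$. More precisely, given $0<\varepsilon<1$ with $s+\varepsilon<0$, there exists $C_{m,s,\varepsilon}>0$ such that $$\big\|\,\|F_M(u)-F_N(u)\|_{H^s}\big\|_{L^p(\mu)}\le C_{m,s,\varepsilon}\,\big(\max(p,2)-1\big)^{m-\frac12}\,\frac1{N^{\varepsilon}}$$ for every finite $p\ge1$ and all integers $M\ge N\ge1$. In particular, for $p\ge2$ the bound is $C_{m,s,\varepsilon}(p-1)^{m-\frac12}N^{-\varepsilon}$. -/

import Mathlib

open MeasureTheory ProbabilityTheory
open scoped ENNReal NNReal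

noncomputable section

namespace WickNLS

/-- Frequencies `n ∈ ℤ²` on the two-dimensional flat torus. -/
abbrev Freq : Type := Fin 2 → ℤ

/-- The square of the Japanese bracket, `⟨n⟩² = 1 + |n|²`, with `|n|` the Euclidean length. -/
def bracketSq (n : Freq) : ℝ := 1 + ((n 0 : ℝ) ^ 2 + (n 1 : ℝ) ^ 2)

/-- The frequencies `n ∈ ℤ²` with `|n| ≤ N` (Euclidean length). -/
def freqBall (N : ℕ) : Finset Freq :=
  (Fintype.piFinset fun _ : Fin 2 => Finset.Icc (-(N : ℤ)) (N : ℤ)).filter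
    fun n => n 0 ^ 2 + n 1 ^ 2 ≤ (N : ℤ) ^ 2

/-- The measure on `ℤ²` that gives the point `n` the mass `⟨n⟩ ^ (2 s)`. -/
def sobolevWeight (s : ℝ) : Measure Freq :=
  Measure.count.withDensity fun n => ENNReal.ofReal (bracketSq n ^ s)

/-- The Sobolev space `H^s(𝕋²)`, a (generalised) function `u = ∑ₙ û(n) e^{i n·x}` on the torus being
identified with the family of its Fourier coefficients `n ↦ û(n)`: it consists of all
`û : ℤ² → ℂ` with `‖u‖² = ∑ₙ ⟨n⟩ ^ (2 s) |û(n)|² < ∞`. Every point of `ℤ²` has positive mass, so that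
equality almost everywhere is equality, and `u n` (the coercion to functions) is `û(n)`. -/
abbrev Hs (s : ℝ) : Type := Lp ℂ 2 (sobolevWeight s)

/-- `H^s(𝕋²)` carries its Borel `σ`-algebra. -/
instance instMeasurableSpaceHs (s : ℝ) : MeasurableSpace (Hs s) := borel (Hs s)

instance instBorelSpaceHs (s : ℝ) : BorelSpace (Hs s) := ⟨rfl⟩

/-! ### The Gaussian free field -/

/-- The law of a standard complex Gaussian `g` (mean `0`, `𝔼|g|² = 1`): its real and imaginary parts
are independent real Gaussians of mean `0` and variance `1/2`. -/
def stdComplexGaussian : Measure ℂ :=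
  ((gaussianReal 0 (1 / 2)).prod (gaussianReal 0 (1 / 2))).map
    fun h : ℝ × ℝ => (⟨h.1, h.2⟩ : ℂ)

/-- The law of a family `(gₙ)`, `n ∈ ℤ²`, of independent standard complex Gaussians. -/
def noiseLaw : Measure (Freq → ℂ) := Measure.infinitePi fun _ : Freq => stdComplexGaussian

/-- The Fourier coefficients `gₙ / (1 + |n|²) ^ (1/2)` of the random series
`u = ∑ₙ gₙ (1 + |n|²) ^ (-1/2) e^{i n·x}`. -/
def seriesCoeff (g : Freq → ℂ) (n : Freq) : ℂ := g n / (Real.sqrt (bracketSq n) : ℂ)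

open Classical in
/-- The random series as an element of `H^s(𝕋²)`; for `s < 0` its coefficients are almost surely those
of an element of `H^s(𝕋²)` (`ae_memLp_seriesCoeff` below), and the value `0` on the exceptional null
set is immaterial. -/
def randomSeries (s : ℝ) (g : Freq → ℂ) : Hs s :=
  if h : MemLp (seriesCoeff g) 2 (sobolevWeight s) then h.toLp (seriesCoeff g) else 0

/-- The massive Gaussian free field `μ` on the torus, as a Borel measure on `H^s(𝕋²)`, `s < 0`:
the law of the random series `∑ₙ gₙ (1 + |n|²) ^ (-1/2) e^{i n·x}`. -/
def gff (s : ℝ) : Measure (Hs s) := noiseLaw.map (randomSeries s)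

/-! ### Wick ordering and the truncated nonlinearity -/

/-- The Hermite polynomial `H_k(x; σ) = σ ^ (k/2) H_k(x / σ ^ (1/2))` with variance parameter `σ > 0`,
where `H_k = H_k(·; 1)` is the (probabilists') Hermite polynomial. -/
def hermiteVar (k : ℕ) (x σ : ℝ) : ℝ :=
  Real.sqrt σ ^ k * Polynomial.aeval (x / Real.sqrt σ) (Polynomial.hermite k)

/-- The Wick ordered monomial `:|z|^{2(m-1)} z:` for a complex Gaussian `z = a + i b` of variance `σ`,
whose real and imaginary parts have variance `σ / 2`. As
`|z|^{2(m-1)} z = ∑ₗ (m-1 choose l) (a^{2l+1} b^{2(m-1-l)} + i a^{2l} b^{2(m-1-l)+1})`,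
Wick ordering the real and imaginary parts separately replaces each `a^j b^k` by
`H_j(a; σ/2) H_k(b; σ/2)`. -/
def wickMonomial (m : ℕ) (σ : ℝ) (z : ℂ) : ℂ :=
  ∑ l ∈ Finset.range m, ((m - 1).choose l : ℂ) *
    ((hermiteVar (2 * l + 1) z.re (σ / 2) * hermiteVar (2 * (m - 1 - l)) z.im (σ / 2) : ℝ) +
      Complex.I *
        (hermiteVar (2 * l) z.re (σ / 2) * hermiteVar (2 * (m - 1 - l) + 1) z.im (σ / 2) : ℝ))

/-- The variance `σ_N = ∑_{|n| ≤ N} 1 / (1 + |n|²)` of `P_N u (x)` under the Gaussian free field. -/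
def sigma (N : ℕ) : ℝ := ∑ n ∈ freqBall N, 1 / bracketSq n

/-- The trigonometric polynomial `P_N u (x) = ∑_{|n| ≤ N} û(n) e^{i n·x}`. A point of `𝕋² = (ℝ / 2πℤ)²`
is written as `x = 2π y` with `y` in `(ℝ / ℤ)²`, so that `e^{i n·x}` is `mFourier n y`. -/
def truncation {s : ℝ} (N : ℕ) (u : Hs s) (y : UnitAddTorus (Fin 2)) : ℂ :=
  ∑ n ∈ freqBall N, u n * UnitAddTorus.mFourier n y

/-- The Fourier coefficients of `P_N (:|P_N u|^{2(m-1)} P_N u:)`. -/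
def nonlinCoeff (m N : ℕ) {s : ℝ} (u : Hs s) (n : Freq) : ℂ :=
  if n ∈ freqBall N then
    UnitAddTorus.mFourierCoeff (fun y => wickMonomial m (sigma N) (truncation N u y)) n
  else 0

lemma bracketSq_pos (n : Freq) : 0 < bracketSq n := by
  unfold bracketSq; positivity

lemma lintegral_sobolevWeight (s : ℝ) (f : Freq → ℝ≥0∞) :
    ∫⁻ n, f n ∂(sobolevWeight s) = ∑' n, ENNReal.ofReal (bracketSq n ^ s) * f n := by
  rw [sobolevWeight, lintegral_withDensity_eq_lintegral_mul _ (measurable_of_countable _)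
    (measurable_of_countable _), lintegral_count]
  rfl

lemma memLp_iff_sobolevWeight (s : ℝ) (f : Freq → ℂ) :
    MemLp f 2 (sobolevWeight s) ↔
      ∑' n, ENNReal.ofReal (bracketSq n ^ s) * ‖f n‖ₑ ^ 2 < ∞ := by
  have h1 : AEStronglyMeasurable f (sobolevWeight s) :=
    (measurable_of_countable f).aestronglyMeasurable
  rw [MemLp, and_iff_right h1, eLpNorm_lt_top_iff_lintegral_rpow_enorm_lt_top (by simp) (by simp),
    lintegral_sobolevWeight]
  simp

lemma memLp_nonlinCoeff (m N : ℕ) {s : ℝ} (u : Hs s) :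
    MemLp (nonlinCoeff m N u) 2 (sobolevWeight s) := by
  rw [memLp_iff_sobolevWeight, tsum_eq_sum (s := freqBall N)]
  · exact ENNReal.sum_lt_top.2 fun n _ =>
      ENNReal.mul_lt_top ENNReal.ofReal_lt_top (ENNReal.pow_lt_top enorm_lt_top)
  · intro n hn
    simp [nonlinCoeff, hn]

/-- The truncated Wick ordered nonlinearity `F_N(u) = P_N (:|P_N u|^{2(m-1)} P_N u:)`. -/
def F (m N : ℕ) {s : ℝ} (u : Hs s) : Hs s := (memLp_nonlinCoeff m N u).toLp (nonlinCoeff m N u)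

/-! ### The Gaussian free field is a probability measure on `H^s`, `s < 0` -/

instance instIsProbabilityMeasureStd : IsProbabilityMeasure stdComplexGaussian :=
  Measure.isProbabilityMeasure_map (by
    refine Measurable.aemeasurable ?_
    exact Complex.measurableEquivRealProd.symm.measurable)

instance instIsProbabilityMeasureNoise : IsProbabilityMeasure noiseLaw := by
  unfold noiseLaw; infer_instance

lemma measurable_seriesCoeff : Measurable seriesCoeff := by
  unfold seriesCoeff
  fun_prop

lemma measurableSet_memLp (s : ℝ) :
    MeasurableSet {g : Freq → ℂ | MemLp (seriesCoeff g) 2 (sobolevWeight s)} := by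
  simp only [memLp_iff_sobolevWeight]
  refine measurableSet_lt ?_ measurable_const
  refine Measurable.tsum fun n => ?_
  have : Measurable fun g : Freq → ℂ => seriesCoeff g n :=
    (measurable_pi_apply n).comp measurable_seriesCoeff
  fun_prop

lemma edist_sq_toLp (s : ℝ) (f : Freq → ℂ) (h : MemLp f 2 (sobolevWeight s)) (v : Hs s) :
    edist (h.toLp f) v =
      (∑' n, ENNReal.ofReal (bracketSq n ^ s) * ‖f n - v n‖ₑ ^ 2) ^ (1 / 2 : ℝ) := by
  rw [Lp.edist_def, eLpNorm_eq_lintegral_rpow_enorm_toReal (by simp) (by simp)]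
  have : ∫⁻ n, ‖((h.toLp f : Freq → ℂ) - v) n‖ₑ ^ (2 : ℝ≥0∞).toReal ∂(sobolevWeight s)
      = ∫⁻ n, ‖f n - v n‖ₑ ^ 2 ∂(sobolevWeight s) := by
    refine lintegral_congr_ae ?_
    filter_upwards [h.coeFn_toLp] with n hn
    simp [hn]
  rw [this, lintegral_sobolevWeight]
  simp

instance instSecondCountableHs (s : ℝ) : SecondCountableTopology (Hs s) := by
  have : SigmaFinite (sobolevWeight s) := by
    unfold sobolevWeight
    exact SigmaFinite.withDensity_ofReal _
  have : Fact ((2 : ℝ≥0∞) ≠ ∞) := ⟨by simp⟩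
  infer_instance

lemma measurable_randomSeries (s : ℝ) : Measurable (randomSeries s) := by
  classical
  have key : ∀ v : Hs s, Measurable fun g => edist (randomSeries s g) v := by
    intro v
    have h2 : (fun g => edist (randomSeries s g) v) = fun g =>
        if MemLp (seriesCoeff g) 2 (sobolevWeight s) then
          (∑' n, ENNReal.ofReal (bracketSq n ^ s) * ‖seriesCoeff g n - v n‖ₑ ^ 2) ^ (1 / 2 : ℝ)
        else edist 0 v := by
      funext g
      unfold randomSeries
      split_ifs with h
      · exact edist_sq_toLp s _ h v
      · rfl
    rw [h2]
    refine Measurable.ite (measurableSet_memLp s) ?_ measurable_const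
    refine Measurable.pow_const (Measurable.tsum fun n => ?_) _
    have : Measurable fun g : Freq → ℂ => seriesCoeff g n :=
      (measurable_pi_apply n).comp measurable_seriesCoeff
    fun_prop
  refine measurable_of_isOpen fun U hU => ?_
  choose! r hr hrU using Metric.isOpen_iff.1 hU
  obtain ⟨T, hT, hTU⟩ := TopologicalSpace.isOpen_iUnion_countable
    (fun x : U => Metric.ball (x : Hs s) (r x)) (fun x => Metric.isOpen_ball)
  have hU' : U = ⋃ x ∈ T, Metric.ball ((x : U) : Hs s) (r x) := by
    rw [hTU]
    refine Set.Subset.antisymm (fun x hx => ?_) (Set.iUnion_subset fun x => hrU x x.2)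
    exact Set.mem_iUnion.2 ⟨⟨x, hx⟩, Metric.mem_ball_self (hr x hx)⟩
  rw [hU', Set.preimage_iUnion₂]
  exact MeasurableSet.biUnion hT fun x _ => by
    have hk : Measurable fun g => dist (randomSeries s g) x := by
      simp only [dist_edist]
      exact (key x).ennreal_toReal
    exact measurableSet_lt hk measurable_const

lemma summable_bracketSq {s : ℝ} (hs : s < 0) : Summable fun n : Freq => bracketSq n ^ (s - 1) := by
  have h1 : Summable fun n : Freq => ‖n‖ ^ (-(2 - 2 * s)) :=
    EisensteinSeries.summable_one_div_norm_rpow (by linarith)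
  refine h1.of_norm_bounded_eventually ?_
  have h0 : ∀ᶠ n : Freq in Filter.cofinite, n ≠ 0 :=
    (Set.finite_singleton (0 : Freq)).subset fun n hn => by simpa using hn
  filter_upwards [h0] with n hn
  have hn' : 0 < ‖n‖ := norm_pos_iff.2 hn
  rw [Real.norm_of_nonneg (Real.rpow_nonneg (bracketSq_pos n).le _)]
  have h2 : ‖n‖ ^ (-(2 - 2 * s)) = (‖n‖ ^ (2 : ℝ)) ^ (s - 1) := by
    rw [← Real.rpow_mul hn'.le]; congr 1; ring
  rw [h2]
  refine Real.rpow_le_rpow_of_nonpos (by positivity) ?_ (by linarith)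
  have h3 : ‖n‖ ≤ Real.sqrt (bracketSq n) := by
    refine (pi_norm_le_iff_of_nonneg (Real.sqrt_nonneg _)).2 fun i => ?_
    rw [Int.norm_eq_abs]
    refine Real.abs_le_sqrt ?_
    unfold bracketSq
    fin_cases i <;> simp <;> nlinarith [sq_nonneg (n 0 : ℝ), sq_nonneg (n 1 : ℝ)]
  calc ‖n‖ ^ (2 : ℝ) = ‖n‖ ^ 2 := by norm_cast
    _ ≤ Real.sqrt (bracketSq n) ^ 2 := by gcongr
    _ = bracketSq n := Real.sq_sqrt (bracketSq_pos n).le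

lemma lintegral_enorm_sq_stdComplexGaussian_lt_top :
    ∫⁻ z, ‖z‖ₑ ^ 2 ∂stdComplexGaussian < ∞ := by
  have hm : Measurable fun h : ℝ × ℝ => (⟨h.1, h.2⟩ : ℂ) :=
    Complex.measurableEquivRealProd.symm.measurable
  rw [stdComplexGaussian, lintegral_map (by fun_prop) hm]
  have hg : MemLp (id : ℝ → ℝ) 2 (gaussianReal 0 (1 / 2)) := memLp_id_gaussianReal 2
  have h1 : MemLp (fun h : ℝ × ℝ => (h.1 : ℂ)) 2
      ((gaussianReal 0 (1 / 2)).prod (gaussianReal 0 (1 / 2))) :=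
    (hg.comp_fst _).ofReal
  have h2 : MemLp (fun h : ℝ × ℝ => (h.2 : ℂ)) 2
      ((gaussianReal 0 (1 / 2)).prod (gaussianReal 0 (1 / 2))) :=
    (hg.comp_snd _).ofReal
  have h3 := (h1.add (h2.mul_const Complex.I)).2
  rw [eLpNorm_lt_top_iff_lintegral_rpow_enorm_lt_top (by simp) (by simp)] at h3
  refine lt_of_eq_of_lt (lintegral_congr fun h => ?_) h3
  simp only [ENNReal.toReal_ofNat, ENNReal.rpow_ofNat, Pi.add_apply]
  congr 2
  apply Complex.ext <;> simp

/-- For `s < 0`, the random series almost surely belongs to `H^s(𝕋²)`. -/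
lemma ae_memLp_seriesCoeff {s : ℝ} (hs : s < 0) :
    ∀ᵐ g ∂noiseLaw, MemLp (seriesCoeff g) 2 (sobolevWeight s) := by
  simp only [memLp_iff_sobolevWeight]
  have hmeas : ∀ n, Measurable fun g : Freq → ℂ =>
      ENNReal.ofReal (bracketSq n ^ s) * ‖seriesCoeff g n‖ₑ ^ 2 := fun n => by
    have : Measurable fun g : Freq → ℂ => seriesCoeff g n :=
      (measurable_pi_apply n).comp measurable_seriesCoeff
    fun_prop
  refine ae_lt_top (Measurable.tsum hmeas) (ne_of_lt ?_)
  rw [lintegral_tsum fun n => (hmeas n).aemeasurable]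
  have hterm : ∀ n, ∫⁻ g, ENNReal.ofReal (bracketSq n ^ s) * ‖seriesCoeff g n‖ₑ ^ 2 ∂noiseLaw
      = ENNReal.ofReal (bracketSq n ^ (s - 1)) * ∫⁻ z, ‖z‖ₑ ^ 2 ∂stdComplexGaussian := by
    intro n
    have hb := bracketSq_pos n
    have h1 : ∀ g : Freq → ℂ, ENNReal.ofReal (bracketSq n ^ s) * ‖seriesCoeff g n‖ₑ ^ 2
        = ENNReal.ofReal (bracketSq n ^ (s - 1)) * ‖g n‖ₑ ^ 2 := by
      intro g
      have e1 : ‖seriesCoeff g n‖ ^ 2 = ‖g n‖ ^ 2 / bracketSq n := by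
        rw [seriesCoeff, norm_div, div_pow, Complex.norm_real,
          Real.norm_of_nonneg (Real.sqrt_nonneg _), Real.sq_sqrt hb.le]
      rw [← ofReal_norm, ← ofReal_norm, ← ENNReal.ofReal_pow (norm_nonneg _),
        ← ENNReal.ofReal_pow (norm_nonneg _), ← ENNReal.ofReal_mul (by positivity),
        ← ENNReal.ofReal_mul (by positivity), e1, Real.rpow_sub_one hb.ne']
      congr 1
      ring
    simp_rw [h1]
    rw [lintegral_const_mul _ (by fun_prop)]
    congr 1
    exact (measurePreserving_eval_infinitePi (fun _ : Freq => stdComplexGaussian) n).lintegral_comp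
      (f := fun z : ℂ => ‖z‖ₑ ^ 2) (by fun_prop)
  simp_rw [hterm]
  rw [ENNReal.tsum_mul_right]
  refine ENNReal.mul_lt_top ?_ lintegral_enorm_sq_stdComplexGaussian_lt_top
  rw [← ENNReal.ofReal_tsum_of_nonneg (fun n => Real.rpow_nonneg (bracketSq_pos n).le _)
    (summable_bracketSq hs)]
  exact ENNReal.ofReal_lt_top

instance instIsProbabilityMeasureGff (s : ℝ) : IsProbabilityMeasure (gff s) :=
  Measure.isProbabilityMeasure_map (measurable_randomSeries s).aemeasurable

end WickNLS

end

/-! Each Fourier coefficient of `F m N u` is a Wick ordered homogeneous polynomial of degree k = 2m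
- 1 in finitely many independent standard real Gaussians, the normalised real and imaginary parts of
the coefficients of `u`. Its coefficient array is explicit (`kernelCoeff`): a product of k factors
of size ⟨n_j⟩⁻¹, restricted to multi-indices whose alternating frequency sum is the output frequency
(`nonlinCoeff_eq_wickVal`). The proof therefore splits into a probabilistic bound by the ℓ² norm of
the coefficients and a lattice sum.

Probabilistic part: `integral_pow_wick_tensorPoly_le` bounds the L^{2(q+1)} norm of a Hilbert-space
valued Wick polynomial of degree k by the square root of (2q+1)^k k! times the ℓ² mass of its
coefficients. In place of a hypercontractive semigroup it uses Gaussian integration by parts. The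
number operator ∑ (X_i - ∂_i) ∂_i acts on Wick polynomials of degree k as multiplication by k, so
the moments of a family are controlled by those of its gradient (`mul_expect_pow_le`,
`expect_pow_le`). The gradient is again such a family, of degree k - 1, and induction on k
concludes.

Lattice part: the kernels for M and N differ only where the output or some input frequency exceeds
N, which lets one trade N^{2ε} for a factor ⟨n_i⟩^{2ε} on one input (`rpow_le_of_not_mem`). The
remaining k-fold sum, with weights ⟨n_j⟩⁻² and ⟨n⟩^{2s} on the output, converges because s + ε < 0:
the frequencies are summed out one at a time, each costing an arbitrarily small power
(`exists_sum_iterated_conv_le`). -/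

noncomputable section

namespace WickNLS

/-! ### Hermite polynomials and Wick ordering of polynomials -/

section WickAlgebra

variable {R : Type*} [CommRing R]

/-- The Hermite polynomials with variance parameter `σ`. -/
def hermitePoly (σ : R) : ℕ → Polynomial R
  | 0 => 1
  | k + 1 => Polynomial.X * hermitePoly σ k - Polynomial.C σ * (hermitePoly σ k).derivative

lemma hermitePoly_map {S : Type*} [CommRing S] (f : R →+* S) (σ : R) (k : ℕ) :
    (hermitePoly σ k).map f = hermitePoly (f σ) k := by
  induction k with
  | zero => simp [hermitePoly]
  | succ k ih => simp [hermitePoly, ih, ← Polynomial.derivative_map]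

lemma hermitePoly_one_eq (k : ℕ) : hermitePoly (1 : ℤ) k = Polynomial.hermite k := by
  induction k with
  | zero => simp [hermitePoly]
  | succ k ih => simp [hermitePoly, Polynomial.hermite_succ, ih]

/-- The chain rule produces a factor t⁻¹, which reduces the t² in the recursion to the t needed at
the next degree. With t = √σ this reconciles the recursive definition with the rescaled one in
`hermiteVar`. -/
lemma hermitePoly_scale (t : ℝ) (ht : t ≠ 0) (k : ℕ) :
    hermitePoly (t ^ 2) k = Polynomial.C (t ^ k) *
      (hermitePoly (1 : ℝ) k).comp (Polynomial.C t⁻¹ * Polynomial.X) := by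
  induction k with
  | zero => simp [hermitePoly]
  | succ k ih =>
    have h : (Polynomial.C t * Polynomial.C t⁻¹ : Polynomial ℝ) = 1 := by
      rw [← Polynomial.C_mul, mul_inv_cancel₀ ht, Polynomial.C_1]
    rw [hermitePoly, ih, hermitePoly, Polynomial.derivative_C_mul, Polynomial.derivative_comp,
      Polynomial.sub_comp, Polynomial.mul_comp, Polynomial.X_comp, Polynomial.mul_comp,
      Polynomial.C_comp, Polynomial.derivative_C_mul, Polynomial.derivative_X]
    simp only [Polynomial.C_pow, Polynomial.C_1]
    linear_combination (-Polynomial.C t ^ k * Polynomial.X *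
        (hermitePoly (1 : ℝ) k).comp (Polynomial.C t⁻¹ * Polynomial.X)
      - Polynomial.C t ^ k * Polynomial.C t *
        (Polynomial.derivative (hermitePoly (1 : ℝ) k)).comp (Polynomial.C t⁻¹ * Polynomial.X)) * h

lemma hermiteVar_eq_eval (k : ℕ) (x : ℝ) {σ : ℝ} (hσ : 0 < σ) :
    hermiteVar k x σ = (hermitePoly σ k).eval x := by
  have h1 : Polynomial.aeval (x / Real.sqrt σ) (Polynomial.hermite k)
      = (hermitePoly (1 : ℝ) k).eval (x / Real.sqrt σ) := by
    rw [← hermitePoly_one_eq, Polynomial.aeval_def, Polynomial.eval₂_eq_eval_map,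
      hermitePoly_map]
    simp
  rw [hermiteVar, h1]
  conv_rhs => rw [← Real.sq_sqrt hσ.le]
  rw [hermitePoly_scale _ (Real.sqrt_pos.2 hσ).ne']
  simp [div_eq_inv_mul]

/-! ### Wick ordering in several variables -/

variable {ι : Type*}

open MvPolynomial

/-- The commutator of two derivations is a derivation, so it is enough that it vanishes on the
variables. -/
lemma pderiv_comm (i j : ι) (P : MvPolynomial ι R) :
    pderiv i (pderiv j P) = pderiv j (pderiv i P) := by
  classical
  have h : ⁅(pderiv i : Derivation R (MvPolynomial ι R) (MvPolynomial ι R)), pderiv (R := R) j⁆ =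
      (0 : Derivation R (MvPolynomial ι R) (MvPolynomial ι R)) := by
    refine derivation_ext fun k => ?_
    rw [Derivation.commutator_apply, pderiv_X, pderiv_X]
    simp only [Pi.single_apply]
    split_ifs <;> simp
  have h1 := DFunLike.congr_fun h P
  rw [Derivation.commutator_apply] at h1
  exact sub_eq_zero.1 h1

lemma pderiv_prod_eq_zero {α : Type*} (i : ι) (s : Finset α) (f : α → MvPolynomial ι R)
    (h : ∀ j ∈ s, pderiv i (f j) = 0) : pderiv i (∏ j ∈ s, f j) = 0 := by
  classical
  induction s using Finset.induction_on with
  | empty => simp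
  | insert j s hj ih =>
    rw [Finset.prod_insert hj, pderiv_mul, h j (by simp),
      ih fun l hl => h l (Finset.mem_insert_of_mem hl)]
    simp

lemma pderiv_aeval_X_self (i : ι) (p : Polynomial R) :
    pderiv i (Polynomial.aeval (X i : MvPolynomial ι R) p) = Polynomial.aeval (X i) p.derivative := by
  rw [Derivation.map_aeval]; simp

lemma pderiv_aeval_X_of_ne {i j : ι} (h : j ≠ i) (p : Polynomial R) :
    pderiv i (Polynomial.aeval (X j : MvPolynomial ι R) p) = 0 := by
  rw [Derivation.map_aeval]; simp [pderiv_X_of_ne h]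

variable [Fintype ι]

/-- Wick ordering of polynomials in independent standard Gaussian variables: the monomial
`∏ Xᵢ ^ dᵢ` is replaced by `∏ H_{dᵢ}(Xᵢ; 1)`. -/
def wick : MvPolynomial ι R →ₗ[R] MvPolynomial ι R :=
  (basisMonomials ι R).constr R fun d => ∏ i, Polynomial.aeval (X i) (hermitePoly (1 : R) (d i))

lemma wick_monomial (d : ι →₀ ℕ) :
    wick (monomial d (1 : R)) = ∏ i, Polynomial.aeval (X i) (hermitePoly (1 : R) (d i)) := by
  have := (basisMonomials ι R).constr_basis R
    (fun d => ∏ i, Polynomial.aeval (X i : MvPolynomial ι R) (hermitePoly (1 : R) (d i))) d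
  simpa [wick] using this

@[simp] lemma wick_one : wick (1 : MvPolynomial ι R) = 1 := by
  have := wick_monomial (R := R) (0 : ι →₀ ℕ)
  simpa [hermitePoly] using this

lemma wick_C (a : R) : wick (C a : MvPolynomial ι R) = C a := by
  have : (C a : MvPolynomial ι R) = a • 1 := by rw [smul_eq_C_mul, mul_one]
  rw [this, map_smul, wick_one]

lemma wick_C_mul (a : R) (P : MvPolynomial ι R) : wick (C a * P) = C a * wick P := by
  rw [← smul_eq_C_mul, map_smul, smul_eq_C_mul]

/-- Wick ordering turns multiplication by X_i into the creation operator X_i - ∂_i; on monomials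
this is the Hermite recursion in the i-th factor. Together with linearity and `wick_one` it
determines `wick`, and it drives every later induction. -/
lemma wick_X_mul (i : ι) (P : MvPolynomial ι R) :
    wick (X i * P) = X i * wick P - pderiv i (wick P) := by
  classical
  induction P using MvPolynomial.induction_on' with
  | add p q hp hq => rw [mul_add, map_add, map_add, hp, hq, map_add]; ring
  | monomial d a =>
    have h0 : monomial d a = C a * monomial d 1 := by rw [C_mul_monomial, mul_one]
    have h1 : X i * monomial d (1 : R) = monomial (d + Finsupp.single i 1) 1 := by
      rw [X, monomial_mul, mul_one, add_comm]
    rw [h0, mul_left_comm, wick_C_mul, wick_C_mul, h1, wick_monomial, wick_monomial]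
    rw [Fintype.prod_eq_mul_prod_compl i, Fintype.prod_eq_mul_prod_compl i]
    have h2 : ∏ j ∈ {i}ᶜ, Polynomial.aeval (X j : MvPolynomial ι R)
        (hermitePoly (1 : R) ((d + Finsupp.single i 1 : ι →₀ ℕ) j))
        = ∏ j ∈ {i}ᶜ, Polynomial.aeval (X j) (hermitePoly (1 : R) (d j)) := by
      refine Finset.prod_congr rfl fun j hj => ?_
      have : j ≠ i := by simpa using hj
      simp [Finsupp.single_eq_of_ne this]
    have h3 : pderiv i (∏ j ∈ {i}ᶜ, Polynomial.aeval (X j : MvPolynomial ι R)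
        (hermitePoly (1 : R) (d j))) = 0 := by
      exact pderiv_prod_eq_zero i _ _ fun j hj => pderiv_aeval_X_of_ne (by simpa using hj) _
    rw [h2, pderiv_mul, pderiv_mul, h3, pderiv_C, pderiv_aeval_X_self]
    simp only [Finsupp.add_apply, Finsupp.single_eq_same, hermitePoly, map_sub, map_mul,
      Polynomial.aeval_X, map_one, one_mul]
    ring

/-- The creation operator X_j - ∂_j has the same commutator with ∂_i as X_j itself, since partial
derivatives commute; induct on the degree. -/
lemma pderiv_wick (i : ι) (P : MvPolynomial ι R) : pderiv i (wick P) = wick (pderiv i P) := by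
  induction P using MvPolynomial.induction_on with
  | C a => simp [wick_C]
  | add p q hp hq => simp [hp, hq]
  | mul_X p j hp =>
    have hc : pderiv i (pderiv j (wick p)) = pderiv j (pderiv i (wick p)) := by
      exact pderiv_comm ..
    rw [mul_comm p, wick_X_mul, map_sub, pderiv_mul, pderiv_mul, map_add, wick_X_mul, hc, hp]
    by_cases h : j = i
    · subst h; simp; ring
    · simp [pderiv_X_of_ne h]

/-- Eigenvalue equation of the number operator: the Wick image of Euler's identity for homogeneous
polynomials. -/
lemma sum_X_mul_wick_pderiv {k : ℕ} {P : MvPolynomial ι R} (hP : P.IsHomogeneous k) :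
    ∑ i, (X i * wick (pderiv i P) - pderiv i (wick (pderiv i P))) = (k : MvPolynomial ι R) * wick P := by
  simp_rw [← wick_X_mul]
  rw [← map_sum, hP.sum_X_mul_pderiv, nsmul_eq_mul]
  have : (k : MvPolynomial ι R) = C (k : R) := by simp
  rw [this, wick_C_mul]

lemma wick_map {S : Type*} [CommRing S] (f : R →+* S) (P : MvPolynomial ι R) :
    map f (wick P) = wick (map f P) := by
  induction P using MvPolynomial.induction_on with
  | C a => simp [wick_C]
  | add p q hp hq => simp [hp, hq]
  | mul_X p j hp =>
    rw [mul_comm p, wick_X_mul, map_sub, map_mul, map_mul, map_X, wick_X_mul, ← pderiv_map, hp]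

/-- The linear form with the coefficients `a`. -/
def linForm (a : ι → R) : MvPolynomial ι R := ∑ i, C (a i) * X i

lemma pderiv_linForm (a : ι → R) (i : ι) : pderiv i (linForm a) = C (a i) := by
  rw [linForm, map_sum, Finset.sum_eq_single i]
  · simp
  · intro j _ hj; simp [pderiv_X_of_ne hj]
  · simp

lemma wick_linForm_mul (a : ι → R) (P : MvPolynomial ι R) :
    wick (linForm a * P) = linForm a * wick P - ∑ i, C (a i) * pderiv i (wick P) := by
  simp only [linForm, Finset.sum_mul, map_sum, mul_assoc, wick_C_mul, wick_X_mul,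
    ← Finset.sum_sub_distrib, mul_sub]

/-- The creation operator in the direction a differentiates along a. Orthogonality kills the
derivative of the second factor, and |a|² = σ supplies the variance in the Hermite recursion. -/
lemma wick_linForm_mul_hermite (a b : ι → R) {σ : R} (haa : ∑ i, a i * a i = σ)
    (hab : ∑ i, a i * b i = 0) (p q : Polynomial R) (P : MvPolynomial ι R)
    (hP : wick P = Polynomial.aeval (linForm a) p * Polynomial.aeval (linForm b) q) :
    wick (linForm a * P) =
      Polynomial.aeval (linForm a) (Polynomial.X * p - Polynomial.C σ * p.derivative) *
        Polynomial.aeval (linForm b) q := by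
  have h : ∑ i, C (a i) * pderiv i (wick P) =
      C σ * Polynomial.aeval (linForm a) p.derivative * Polynomial.aeval (linForm b) q := by
    have h1 : ∀ i, C (a i) * pderiv i (wick P) =
        C (a i * a i) * (Polynomial.aeval (linForm a) p.derivative * Polynomial.aeval (linForm b) q)
        + C (a i * b i) *
          (Polynomial.aeval (linForm a) p * Polynomial.aeval (linForm b) q.derivative) := by
      intro i
      rw [hP, pderiv_mul, Derivation.map_aeval, Derivation.map_aeval, pderiv_linForm,
        pderiv_linForm, C_mul, C_mul, smul_eq_mul, smul_eq_mul]
      ring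
    simp_rw [h1]
    rw [Finset.sum_add_distrib, ← Finset.sum_mul, ← Finset.sum_mul, ← map_sum, ← map_sum, haa, hab]
    simp [mul_assoc]
  rw [wick_linForm_mul, h, hP]
  simp only [map_sub, map_mul, Polynomial.aeval_X, Polynomial.aeval_C, algebraMap_eq]
  ring

/-- Ordering in the coordinates agrees with ordering two orthogonal Gaussian combinations
separately. This identifies the prescribed Wick ordering of real and imaginary parts with `wick`. -/
lemma wick_linForm_pow_mul_pow (a b : ι → R) {σ : R} (haa : ∑ i, a i * a i = σ)
    (hbb : ∑ i, b i * b i = σ) (hab : ∑ i, a i * b i = 0) (j k : ℕ) :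
    wick (linForm a ^ j * linForm b ^ k) =
      Polynomial.aeval (linForm a) (hermitePoly σ j) *
        Polynomial.aeval (linForm b) (hermitePoly σ k) := by
  induction j with
  | zero =>
    induction k with
    | zero => simp [hermitePoly]
    | succ k ih =>
      have hba : ∑ i, b i * a i = 0 := by simpa [mul_comm] using hab
      have h := wick_linForm_mul_hermite b a hbb hba (hermitePoly σ k) (hermitePoly σ 0)
        (linForm a ^ 0 * linForm b ^ k) (by rw [ih, mul_comm])
      rw [pow_succ', mul_left_comm, h, mul_comm]
      rfl
  | succ j ih =>
    rw [pow_succ', mul_assoc]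
    exact wick_linForm_mul_hermite a b haa hab _ _ _ ih

end WickAlgebra

/-! ### Moments of Wick ordered polynomials -/

section Moments

open MvPolynomial

/-- The homogeneous polynomial `∑ c_ν X_{ν 0} ⋯ X_{ν (k-1)}`. -/
def tensorPoly {R ι : Type*} [CommRing R] [Fintype ι] {k : ℕ} (c : (Fin k → ι) → R) :
    MvPolynomial ι R :=
  ∑ ν, C (c ν) * ∏ j, X (ν j)

lemma isHomogeneous_tensorPoly {R ι : Type*} [CommRing R] [Fintype ι] {k : ℕ}
    (c : (Fin k → ι) → R) : (tensorPoly c).IsHomogeneous k := by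
  refine IsHomogeneous.sum _ _ _ fun ν _ => ?_
  have h : (∏ j : Fin k, (X (ν j) : MvPolynomial ι R)).IsHomogeneous (∑ _j : Fin k, 1) :=
    IsHomogeneous.prod _ _ _ fun j _ => isHomogeneous_X _ _
  simpa using (isHomogeneous_C ι (c ν)).mul h

lemma pderiv_prod_X {R ι : Type*} [CommRing R] [DecidableEq ι] {k : ℕ} (i : ι)
    (ν : Fin (k + 1) → ι) :
    pderiv i (∏ j, (X (ν j) : MvPolynomial ι R)) =
      ∑ j, if ν j = i then ∏ l, X (j.removeNth ν l) else 0 := by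
  induction k with
  | zero =>
    rw [Fin.prod_univ_succ, Fin.sum_univ_succ]
    simp [pderiv_X, Pi.single_apply, eq_comm]
  | succ k ih =>
    rw [Fin.prod_univ_succ, pderiv_mul, ih (fun j => ν j.succ), Finset.mul_sum]
    conv_rhs => rw [Fin.sum_univ_succ]
    congr 1
    · rw [pderiv_X, Pi.single_apply]
      by_cases h : ν 0 = i
      · simp [h, Fin.removeNth]
      · simp [h]
    · refine Finset.sum_congr rfl fun j _ => ?_
      split_ifs with h
      · rw [Fin.prod_univ_succ]
        simp [Fin.removeNth]
      · simp

lemma pderiv_tensorPoly {R ι : Type*} [CommRing R] [Fintype ι] [DecidableEq ι] {k : ℕ} (i : ι)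
    (c : (Fin (k + 1) → ι) → R) :
    pderiv i (tensorPoly c) =
      ∑ j : Fin (k + 1), tensorPoly fun ν : Fin k → ι => c (j.insertNth i ν) := by
  simp only [tensorPoly, map_sum, pderiv_C_mul, pderiv_prod_X, Finset.mul_sum]
  rw [Finset.sum_comm]
  refine Finset.sum_congr rfl fun j _ => ?_
  rw [← (Fin.insertNthEquiv (fun _ => ι) j).sum_comp, Fintype.sum_prod_type,
    Finset.sum_eq_single i]
  · refine Finset.sum_congr rfl fun ν _ => ?_
    simp [Fin.insertNthEquiv]
  · intro i' _ h
    refine Finset.sum_eq_zero fun ν _ => ?_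
    simp [Fin.insertNthEquiv, h]
  · simp

/-- For each slot j, inserting i at j is a bijection onto the multi-indices of length k + 1, so
every slot contributes the full ℓ² mass. -/
lemma sum_insertNth_sq {ι : Type*} [Fintype ι] {k : ℕ} (c : (Fin (k + 1) → ι) → ℝ) :
    ∑ i, ∑ j : Fin (k + 1), ∑ ν : Fin k → ι, c (j.insertNth i ν) ^ 2
      = (k + 1) * ∑ ν, c ν ^ 2 := by
  rw [Finset.sum_comm]
  have h : ∀ j : Fin (k + 1), ∑ i, ∑ ν : Fin k → ι, c (j.insertNth i ν) ^ 2 = ∑ ν, c ν ^ 2 := by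
    intro j
    rw [← (Fin.insertNthEquiv (fun _ => ι) j).sum_comp, Fintype.sum_prod_type]
    rfl
  simp [h]

variable {ι Ω : Type} [MeasurableSpace Ω]

/-- The family `x` satisfies the Gaussian integration by parts formula for polynomials, i.e. its
coordinates have the joint moments of independent standard Gaussian variables. -/
structure IsGaussianSystem (μ : Measure Ω) (x : Ω → ι → ℝ) : Prop where
  integrable : ∀ P : MvPolynomial ι ℝ, Integrable (fun ω => eval (x ω) P) μ
  ibp : ∀ (P : MvPolynomial ι ℝ) (i : ι),
    ∫ ω, eval (x ω) (pderiv i P) ∂μ = ∫ ω, eval (x ω) (X i * P) ∂μ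

namespace IsGaussianSystem

variable {μ : Measure Ω} {x : Ω → ι → ℝ}

/-- The expectation of a polynomial. -/
def expect (h : IsGaussianSystem μ x) : MvPolynomial ι ℝ →ₗ[ℝ] ℝ where
  toFun P := ∫ ω, eval (x ω) P ∂μ
  map_add' P Q := by
    simp only [map_add]
    exact integral_add (h.integrable P) (h.integrable Q)
  map_smul' a P := by
    simp only [smul_eval, RingHom.id_apply, smul_eq_mul]
    exact integral_const_mul _ _

variable (h : IsGaussianSystem μ x)

lemma expect_mono {P Q : MvPolynomial ι ℝ} (hPQ : ∀ ω, eval (x ω) P ≤ eval (x ω) Q) :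
    h.expect P ≤ h.expect Q :=
  integral_mono (h.integrable P) (h.integrable Q) hPQ

/-- Creation and annihilation are adjoint: integration by parts applied to the product PQ. -/
lemma expect_creation_mul (i : ι) (P Q : MvPolynomial ι ℝ) :
    h.expect ((X i * P - pderiv i P) * Q) = h.expect (P * pderiv i Q) := by
  have h1 : h.expect (pderiv i (P * Q)) = h.expect (X i * (P * Q)) := h.ibp _ _
  rw [pderiv_mul, map_add] at h1
  have h2 : (X i * P - pderiv i P) * Q = X i * (P * Q) - pderiv i P * Q := by ring
  rw [h2, map_sub, ← h1]
  ring

variable [Fintype ι]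

lemma expect_numberOp_mul {k : ℕ} {P : MvPolynomial ι ℝ} (hP : P.IsHomogeneous k)
    (Q : MvPolynomial ι ℝ) :
    (k : ℝ) * h.expect (wick P * Q) = ∑ i, h.expect (wick (pderiv i P) * pderiv i Q) := by
  simp_rw [← expect_creation_mul]
  rw [← map_sum, ← Finset.sum_mul, sum_X_mul_wick_pderiv hP, mul_assoc, ← nsmul_eq_mul,
    ← nsmul_eq_mul, map_nsmul]

variable {α : Type} [Fintype α]

/-- Write Q = ∑ W_a² and Q^{q+1} = ∑ W_a (W_a Q^q), and move the number operator across by parts.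
The derivative falling on W_a gives |∇W|² Q^q; the one falling on Q^q gives 2q Q^{q-1} ∑_i (∑_a W_a
∂_i W_a)², which Cauchy–Schwarz bounds by 2q |∇W|² Q^q. -/
lemma mul_expect_pow_le {k : ℕ} {P : α → MvPolynomial ι ℝ} (hP : ∀ a, (P a).IsHomogeneous k)
    (q : ℕ) :
    (k : ℝ) * h.expect ((∑ a, wick (P a) ^ 2) ^ (q + 1)) ≤
      (2 * q + 1) * h.expect
        ((∑ a, ∑ i, wick (pderiv i (P a)) ^ 2) * (∑ a, wick (P a) ^ 2) ^ q) := by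
  set W : α → MvPolynomial ι ℝ := fun a => wick (P a) with hW
  set D : α → ι → MvPolynomial ι ℝ := fun a i => wick (pderiv i (P a)) with hD
  set Q : MvPolynomial ι ℝ := ∑ a, W a ^ 2 with hQ
  have hDW : ∀ a i, pderiv i (W a) = D a i := fun a i => pderiv_wick i (P a)
  have hdQ : ∀ i, pderiv i Q = 2 * ∑ a, W a * D a i := by
    intro i
    rw [hQ, map_sum, Finset.mul_sum]
    refine Finset.sum_congr rfl fun a _ => ?_
    rw [pderiv_pow, hDW]
    simp [mul_assoc]
  have h1 : (k : ℝ) * h.expect (Q ^ (q + 1)) =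
      h.expect ((∑ a, ∑ i, D a i ^ 2) * Q ^ q
        + (2 * q) * (Q ^ (q - 1) * ∑ i, (∑ a, W a * D a i) ^ 2)) := by
    have e1 : Q ^ (q + 1) = ∑ a, W a * (W a * Q ^ q) := by
      rw [pow_succ', ← Finset.sum_congr rfl fun a _ => mul_assoc _ _ _, ← Finset.sum_mul]
      simp only [hQ, pow_two]
    rw [e1, map_sum, Finset.mul_sum]
    simp_rw [hW, expect_numberOp_mul h (hP _)]
    rw [← Finset.sum_congr rfl fun a _ => map_sum h.expect _ _, ← map_sum]
    congr 1
    change ∑ a, ∑ i, D a i * pderiv i (W a * Q ^ q) = _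
    have e2 : ∀ a i, D a i * pderiv i (W a * Q ^ q) =
        D a i ^ 2 * Q ^ q + (2 * q) * (Q ^ (q - 1) * ((∑ b, W b * D b i) * (W a * D a i))) := by
      intro a i
      rw [pderiv_mul, pderiv_pow, hDW, hdQ]
      ring
    simp_rw [e2, Finset.sum_add_distrib, ← Finset.sum_mul]
    congr 1
    rw [Finset.sum_comm]
    simp_rw [← Finset.mul_sum]
    congr 3
    funext i
    ring
  rw [h1]
  have h2 : (2 * q + 1 : ℝ) * h.expect ((∑ a, ∑ i, D a i ^ 2) * Q ^ q) =
      h.expect ((2 * q + 1 : ℝ) • ((∑ a, ∑ i, D a i ^ 2) * Q ^ q)) := by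
    rw [map_smul, smul_eq_mul]
  rw [h2]
  refine h.expect_mono fun ω => ?_
  simp only [smul_eval, map_add, map_mul, map_pow, map_sum, map_natCast, map_ofNat, hQ]
  set w : α → ℝ := fun a => eval (x ω) (W a)
  set d : α → ι → ℝ := fun a i => eval (x ω) (D a i)
  change (∑ a, ∑ i, d a i ^ 2) * (∑ a, w a ^ 2) ^ q
      + 2 * q * ((∑ a, w a ^ 2) ^ (q - 1) * ∑ i, (∑ a, w a * d a i) ^ 2)
    ≤ (2 * q + 1) * ((∑ a, ∑ i, d a i ^ 2) * (∑ a, w a ^ 2) ^ q)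
  -- For q = 0 the truncated exponent q - 1 is harmless, its term having the factor q.
  rcases q with _ | q
  · simp
  have hw : 0 ≤ ∑ a, w a ^ 2 := Finset.sum_nonneg fun a _ => sq_nonneg _
  have hcs : ∑ i, (∑ a, w a * d a i) ^ 2 ≤ (∑ a, w a ^ 2) * ∑ a, ∑ i, d a i ^ 2 := by
    rw [Finset.sum_comm, Finset.mul_sum]
    exact Finset.sum_le_sum fun i _ => Finset.sum_mul_sq_le_sq_mul_sq _ _ _
  have h3 : (∑ a, w a ^ 2) ^ q * ∑ i, (∑ a, w a * d a i) ^ 2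
      ≤ (∑ a, ∑ i, d a i ^ 2) * (∑ a, w a ^ 2) ^ (q + 1) := by
    refine (mul_le_mul_of_nonneg_left hcs (pow_nonneg hw q)).trans (le_of_eq ?_)
    ring
  have h4 := mul_le_mul_of_nonneg_left h3 (by positivity : (0 : ℝ) ≤ 2 * ((q + 1 : ℕ) : ℝ))
  simp only [Nat.add_sub_cancel]
  linarith

end IsGaussianSystem

/-- Young's inequality with integer exponents: the defect at q + 1 is s times the defect at q plus
(q + 1) r^q (s - r)². -/
lemma young_pow {s r : ℝ} (hs : 0 ≤ s) (hr : 0 ≤ r) (q : ℕ) :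
    (q + 1) * (s * r ^ q) ≤ s ^ (q + 1) + q * r ^ (q + 1) := by
  induction q with
  | zero => simp
  | succ q ih =>
    have h1 : 0 ≤ s * (s ^ (q + 1) + q * r ^ (q + 1) - (q + 1) * (s * r ^ q)) :=
      mul_nonneg hs (by linarith)
    have h2 : 0 ≤ (q + 1 : ℝ) * r ^ q * (s - r) ^ 2 := by positivity
    push_cast
    have h3 : s ^ (q + 1 + 1) + (q + 1) * r ^ (q + 1 + 1) - (q + 1 + 1) * (s * r ^ (q + 1))
        = s * (s ^ (q + 1) + q * r ^ (q + 1) - (q + 1) * (s * r ^ q))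
          + (q + 1 : ℝ) * r ^ q * (s - r) ^ 2 := by ring
    linarith

namespace IsGaussianSystem

variable [Fintype ι] {μ : Measure Ω} {x : Ω → ι → ℝ} (h : IsGaussianSystem μ x)
variable {α : Type} [Fintype α]

/-- Young's inequality separates the gradient from Q^q in `mul_expect_pow_le`, and the resulting
multiple of the expectation of Q^{q+1} is absorbed on the left; all these moments are finite. -/
lemma expect_pow_le {k : ℕ} (hk : 0 < k) {P : α → MvPolynomial ι ℝ}
    (hP : ∀ a, (P a).IsHomogeneous k) (q : ℕ) :
    h.expect ((∑ a, wick (P a) ^ 2) ^ (q + 1)) ≤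
      h.expect ((((2 * q + 1 : ℝ) / k) • ∑ a, ∑ i, wick (pderiv i (P a)) ^ 2) ^ (q + 1)) := by
  have h0 := mul_expect_pow_le h hP q
  obtain ⟨Q, hQ⟩ : ∃ Q, Q = ∑ a, wick (P a) ^ 2 := ⟨_, rfl⟩
  obtain ⟨G, hG⟩ : ∃ G, G = ((2 * q + 1 : ℝ) / k) • ∑ a, ∑ i, wick (pderiv i (P a)) ^ 2 := ⟨_, rfl⟩
  have hk' : (0 : ℝ) < k := by exact_mod_cast hk
  have h1 : h.expect (Q ^ (q + 1)) ≤ h.expect (G * Q ^ q) := by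
    rw [hG, smul_mul_assoc, map_smul, smul_eq_mul, div_mul_eq_mul_div, le_div_iff₀ hk', hQ,
      mul_comm]
    exact h0
  rw [← hQ, ← hG]
  have h2 : h.expect (((q + 1 : ℝ)) • (G * Q ^ q)) ≤
      h.expect (G ^ (q + 1) + (q : ℝ) • Q ^ (q + 1)) := by
    refine h.expect_mono fun ω => ?_
    have hQ0 : 0 ≤ eval (x ω) Q := by
      simp only [hQ, map_sum, map_pow]; positivity
    have hG0 : 0 ≤ eval (x ω) G := by
      simp only [hG, smul_eval, map_sum, map_pow]; positivity
    simp only [smul_eval, map_add, map_mul, map_pow]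
    exact young_pow hG0 hQ0 q
  simp only [map_add, map_smul, smul_eq_mul] at h2
  have h3 := mul_le_mul_of_nonneg_left h1 (by positivity : (0 : ℝ) ≤ q + 1)
  linarith

/-- Induction on the degree, for all finite families at once: the gradient of a family over α is
treated as a family over α × ι × Fin (k + 1), one member for each differentiated slot. -/
theorem integral_pow_wick_tensorPoly_le [IsProbabilityMeasure μ] (h : IsGaussianSystem μ x) (k q : ℕ)
    (c : α → (Fin k → ι) → ℝ) :
    ∫ ω, (∑ a, eval (x ω) (wick (tensorPoly (c a))) ^ 2) ^ (q + 1) ∂μ ≤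
      ((2 * q + 1) ^ k * k.factorial * ∑ a, ∑ ν, c a ν ^ 2) ^ (q + 1) := by
  classical
  induction k generalizing α with
  | zero =>
    have h1 : ∀ a, tensorPoly (c a) = C (c a default) := fun a => by
      rw [tensorPoly, Fintype.sum_unique, Finset.prod_of_isEmpty, mul_one]
    simp [h1, wick_C]
  | succ k ih =>
    have hstep := h.expect_pow_le (Nat.succ_pos k)
      (fun a => isHomogeneous_tensorPoly (c a)) q
    have e1 : h.expect ((∑ a, wick (tensorPoly (c a)) ^ 2) ^ (q + 1)) =
        ∫ ω, (∑ a, eval (x ω) (wick (tensorPoly (c a))) ^ 2) ^ (q + 1) ∂μ := by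
      simp [expect]
    rw [← e1]
    refine hstep.trans ?_
    let c' : α × ι × Fin (k + 1) → (Fin k → ι) → ℝ :=
      fun t ν => c t.1 (t.2.2.insertNth t.2.1 ν)
    have h2 : h.expect ((((2 * q + 1 : ℝ) / (k + 1 : ℕ)) •
          ∑ a, ∑ i, wick (pderiv i (tensorPoly (c a))) ^ 2) ^ (q + 1)) ≤
        h.expect (((2 * q + 1 : ℝ) • ∑ t, wick (tensorPoly (c' t)) ^ 2) ^ (q + 1)) := by
      refine h.expect_mono fun ω => ?_
      simp only [smul_eval, map_pow, map_sum]
      refine pow_le_pow_left₀ (by positivity) ?_ _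
      rw [div_mul_eq_mul_div, div_le_iff₀ (by positivity), mul_assoc]
      refine mul_le_mul_of_nonneg_left ?_ (by positivity)
      rw [Fintype.sum_prod_type, Finset.sum_mul]
      refine Finset.sum_le_sum fun a _ => ?_
      rw [Fintype.sum_prod_type, Finset.sum_mul]
      refine Finset.sum_le_sum fun i _ => ?_
      rw [pderiv_tensorPoly, map_sum, map_sum, mul_comm]
      -- Cauchy–Schwarz over the k + 1 slots; its constant cancels the division by k + 1. The
      -- factorial comes instead from `sum_insertNth_sq`.
      refine (sq_sum_le_card_mul_sum_sq).trans (le_of_eq ?_)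
      simp [c']
    have h3 : h.expect (((2 * q + 1 : ℝ) • ∑ t, wick (tensorPoly (c' t)) ^ 2) ^ (q + 1)) =
        (2 * q + 1) ^ (q + 1) *
          ∫ ω, (∑ t, eval (x ω) (wick (tensorPoly (c' t))) ^ 2) ^ (q + 1) ∂μ := by
      rw [smul_pow, map_smul, smul_eq_mul]
      simp [expect]
    refine h2.trans ?_
    rw [h3]
    refine (mul_le_mul_of_nonneg_left (ih c') (by positivity)).trans (le_of_eq ?_)
    rw [← mul_pow]
    congr 1
    have h4 : ∑ t, ∑ ν, c' t ν ^ 2 = (k + 1) * ∑ a, ∑ ν, c a ν ^ 2 := by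
      rw [Fintype.sum_prod_type, Finset.mul_sum]
      refine Finset.sum_congr rfl fun a _ => ?_
      rw [Fintype.sum_prod_type, ← sum_insertNth_sq]
    rw [h4, Nat.factorial_succ]
    push_cast
    ring

end IsGaussianSystem

end Moments

/-! ### The Wick ordered monomial as a Wick ordered polynomial -/

section Expansion

open MvPolynomial

lemma prod_linForm {R ι : Type*} [CommRing R] [Fintype ι] {k : ℕ} (w : Fin k → ι → R) :
    ∏ j, linForm (w j) = tensorPoly fun ν : Fin k → ι => ∏ j, w j (ν j) := by
  classical
  simp only [linForm, tensorPoly]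
  rw [Finset.prod_univ_sum, Fintype.piFinset_univ]
  refine Finset.sum_congr rfl fun ν _ => ?_
  rw [Finset.prod_mul_distrib, map_prod]

lemma prod_alternating {R : Type*} [CommMonoid R] (u v : R) (n : ℕ) :
    ∏ j : Fin (2 * n + 1), (if Even (j : ℕ) then u else v) = (u * v) ^ n * u := by
  rw [Fin.prod_univ_eq_prod_range (fun j => if Even j then u else v)]
  induction n with
  | zero => simp
  | succ n ih =>
    have h1 : ¬ Even (2 * n + 1) := by simp
    have h2 : Even (2 * n + 1 + 1) := ⟨n + 1, by ring⟩
    rw [show 2 * (n + 1) + 1 = 2 * n + 1 + 1 + 1 by ring, Finset.prod_range_succ,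
      Finset.prod_range_succ, ih, if_neg h1, if_pos h2, pow_succ, mul_assoc, mul_assoc, mul_assoc,
      mul_assoc]

variable {ι : Type} [Fintype ι]

/-- The value at `x` of the Wick ordered polynomial with the complex coefficients `c`. -/
def wickVal {k : ℕ} (c : (Fin k → ι) → ℂ) (x : ι → ℝ) : ℂ :=
  ∑ ν, c ν * (eval x (wick (∏ j, X (ν j))) : ℝ)

lemma eval_wick_tensorPoly {k : ℕ} (c : (Fin k → ι) → ℂ) (x : ι → ℝ) :
    eval (fun i => (x i : ℂ)) (wick (tensorPoly c)) = wickVal c x := by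
  classical
  simp only [tensorPoly, map_sum, wick_C_mul, map_mul, eval_C, wickVal]
  refine Finset.sum_congr rfl fun ν _ => ?_
  congr 1
  have h1 : wick (∏ j, (X (ν j) : MvPolynomial ι ℂ)) =
      map Complex.ofRealHom (wick (∏ j, (X (ν j) : MvPolynomial ι ℝ))) := by
    rw [wick_map, map_prod (map Complex.ofRealHom)]
    simp only [map_X]
  rw [h1, eval_map, eval₂_eq_eval_map]
  exact (map_eval Complex.ofRealHom x _).symm ▸ rfl

lemma wickVal_re {k : ℕ} (c : (Fin k → ι) → ℂ) (x : ι → ℝ) :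
    (wickVal c x).re = eval x (wick (tensorPoly fun ν => (c ν).re)) := by
  simp only [tensorPoly, map_sum, wick_C_mul, map_mul, eval_C, wickVal, Complex.re_sum,
    Complex.re_mul_ofReal]

lemma wickVal_im {k : ℕ} (c : (Fin k → ι) → ℂ) (x : ι → ℝ) :
    (wickVal c x).im = eval x (wick (tensorPoly fun ν => (c ν).im)) := by
  simp only [tensorPoly, map_sum, wick_C_mul, map_mul, eval_C, wickVal, Complex.im_sum,
    Complex.im_mul_ofReal]

lemma eval_aeval_linForm (a x : ι → ℝ) (p : Polynomial ℝ) :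
    eval (fun i => (x i : ℂ)) (Polynomial.aeval (linForm fun i => (a i : ℂ))
      (p.map Complex.ofRealHom)) = ((p.eval (∑ i, a i * x i) : ℝ) : ℂ) := by
  have h1 : eval (fun i => (x i : ℂ)) (linForm fun i => (a i : ℂ)) =
      ((∑ i, a i * x i : ℝ) : ℂ) := by
    simp [linForm]
  rw [Polynomial.aeval_def, Polynomial.hom_eval₂, h1, Polynomial.eval₂_map]
  have h2 : ((eval fun i => (x i : ℂ)).comp (algebraMap ℂ (MvPolynomial ι ℂ))).comp
      Complex.ofRealHom = Complex.ofRealHom := by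
    ext; simp
  rw [h2]
  exact Polynomial.eval₂_hom Complex.ofRealHom _

lemma eval_wick_linForm_pow_mul_pow (a b x : ι → ℝ) {σ : ℝ} (hσ : 0 < σ)
    (haa : ∑ i, a i * a i = σ) (hbb : ∑ i, b i * b i = σ) (hab : ∑ i, a i * b i = 0) (j k : ℕ) :
    eval (fun i => (x i : ℂ))
      (wick (linForm (fun i => (a i : ℂ)) ^ j * linForm (fun i => (b i : ℂ)) ^ k)) =
      ((hermiteVar j (∑ i, a i * x i) σ * hermiteVar k (∑ i, b i * x i) σ : ℝ) : ℂ) := by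
  classical
  rw [wick_linForm_pow_mul_pow (σ := (σ : ℂ)) _ _ (by exact_mod_cast haa) (by exact_mod_cast hbb)
    (by exact_mod_cast hab), map_mul, Complex.ofReal_mul, hermiteVar_eq_eval _ _ hσ,
    hermiteVar_eq_eval _ _ hσ, ← eval_aeval_linForm, ← eval_aeval_linForm, hermitePoly_map,
    hermitePoly_map]
  rfl

/-- The Wick ordered monomial of a Gaussian variable `∑ wᵢ xᵢ` is the Wick ordering of the
corresponding polynomial. -/
lemma wickMonomial_eq_wickVal {m : ℕ} (hm : 1 ≤ m) (w : ι → ℂ) (x : ι → ℝ) {σ : ℝ} (hσ : 0 < σ)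
    (haa : ∑ i, (w i).re * (w i).re = σ / 2) (hbb : ∑ i, (w i).im * (w i).im = σ / 2)
    (hab : ∑ i, (w i).re * (w i).im = 0) :
    wickMonomial m σ (∑ i, w i * x i) =
      wickVal (fun ν : Fin (2 * (m - 1) + 1) → ι =>
        ∏ j : Fin (2 * (m - 1) + 1), (if Even (j : ℕ) then w (ν j) else starRingEnd ℂ (w (ν j)))) x := by
  rw [← eval_wick_tensorPoly]
  have h1 := prod_linForm fun (j : Fin (2 * (m - 1) + 1)) i =>
    if Even (j : ℕ) then w i else starRingEnd ℂ (w i)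
  rw [← h1]
  have h2 : ∀ j : Fin (2 * (m - 1) + 1),
      linForm (fun i => if Even (j : ℕ) then w i else starRingEnd ℂ (w i)) =
        if Even (j : ℕ) then linForm w else linForm fun i => starRingEnd ℂ (w i) := by
    intro j; split_ifs <;> rfl
  rw [Finset.prod_congr rfl fun j _ => h2 j, prod_alternating]
  set a : MvPolynomial ι ℂ := linForm fun i => ((w i).re : ℂ) with ha
  set b : MvPolynomial ι ℂ := linForm fun i => ((w i).im : ℂ) with hb
  have hw : linForm w = a + C Complex.I * b := by
    simp only [ha, hb, linForm, Finset.mul_sum, ← Finset.sum_add_distrib]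
    refine Finset.sum_congr rfl fun i _ => ?_
    conv_lhs => rw [← Complex.re_add_im (w i)]
    rw [C_add, C_mul]; ring
  have hw' : linForm (fun i => starRingEnd ℂ (w i)) = a - C Complex.I * b := by
    simp only [ha, hb, linForm, Finset.mul_sum, ← Finset.sum_sub_distrib]
    refine Finset.sum_congr rfl fun i _ => ?_
    conv_lhs => rw [← Complex.re_add_im (starRingEnd ℂ (w i)), Complex.conj_re, Complex.conj_im]
    rw [C_add, C_mul, Complex.ofReal_neg, C_neg]; ring
  have hII : (C Complex.I * C Complex.I : MvPolynomial ι ℂ) = -1 := by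
    rw [← C_mul, Complex.I_mul_I, C_neg, C_1]
  have h3 : (linForm w * linForm fun i => starRingEnd ℂ (w i)) = a ^ 2 + b ^ 2 := by
    rw [hw, hw']; linear_combination (-b ^ 2) * hII
  -- The binomial expansion of (a² + b²)^{m-1} (a + ib), whose terms are exactly those of
  -- `wickMonomial` before ordering.
  have h4 : (linForm w * linForm fun i => starRingEnd ℂ (w i)) ^ (m - 1) * linForm w =
      ∑ l ∈ Finset.range m, C ((m - 1).choose l : ℂ) * (a ^ (2 * l + 1) * b ^ (2 * (m - 1 - l)) +
        C Complex.I * (a ^ (2 * l) * b ^ (2 * (m - 1 - l) + 1))) := by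
    rw [h3, hw, add_pow, Nat.sub_add_cancel hm, Finset.sum_mul]
    refine Finset.sum_congr rfl fun l _ => ?_
    rw [← pow_mul, ← pow_mul]
    simp only [map_natCast]
    ring
  rw [h4]
  have hzr : (∑ i, w i * x i).re = ∑ i, (w i).re * x i := by simp
  have hzi : (∑ i, w i * x i).im = ∑ i, (w i).im * x i := by simp
  have hσ2 : 0 < σ / 2 := by linarith
  rw [wickMonomial, map_sum, map_sum, hzr, hzi]
  refine Finset.sum_congr rfl fun l _ => ?_
  rw [wick_C_mul, map_add, wick_C_mul, map_mul, map_add (eval _), map_mul (eval _), eval_C, eval_C,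
    eval_wick_linForm_pow_mul_pow _ _ x hσ2 haa hbb hab,
    eval_wick_linForm_pow_mul_pow _ _ x hσ2 haa hbb hab]

end Expansion

/-! ### The Fourier coefficients of the truncated nonlinearity -/

section FourierCoefficients

/-- The real coordinates of `u` that are independent standard Gaussian variables under the Gaussian
free field. -/
def gaussCoord (M : ℕ) (u : Freq → ℂ) (i : freqBall M × Bool) : ℝ :=
  Real.sqrt 2 * Real.sqrt (bracketSq i.1) * if i.2 then (u i.1).im else (u i.1).re

/-- The coefficient of a Gaussian coordinate in the `n`-th Fourier coefficient. -/
def coordCoeff (n : Freq) (b : Bool) : ℂ :=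
  (if b then Complex.I else 1) / ((Real.sqrt 2 * Real.sqrt (bracketSq n) : ℝ) : ℂ)

lemma sqrt_two_mul_pos (n : Freq) : 0 < Real.sqrt 2 * Real.sqrt (bracketSq n) :=
  mul_pos (by positivity) (Real.sqrt_pos.2 (bracketSq_pos n))

lemma sum_coordCoeff_mul_gaussCoord (M : ℕ) (u : Freq → ℂ) (n : freqBall M) :
    ∑ b, coordCoeff n b * gaussCoord M u (n, b) = u n := by
  have h := (sqrt_two_mul_pos n).ne'
  have h' : ((Real.sqrt 2 * Real.sqrt (bracketSq n) : ℝ) : ℂ) ≠ 0 := by exact_mod_cast h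
  conv_rhs => rw [← Complex.re_add_im (u n)]
  simp only [Fintype.sum_bool, coordCoeff, gaussCoord, if_true, Bool.false_eq_true, if_false]
  rw [Complex.ofReal_mul (Real.sqrt 2 * Real.sqrt (bracketSq n)),
    Complex.ofReal_mul (Real.sqrt 2 * Real.sqrt (bracketSq n))]
  field_simp
  ring

/-- The coefficients of `P_N u (y)` in the Gaussian coordinates. -/
def fieldCoeff (M N : ℕ) (y : UnitAddTorus (Fin 2)) (i : freqBall M × Bool) : ℂ :=
  if (i.1 : Freq) ∈ freqBall N then coordCoeff i.1 i.2 * UnitAddTorus.mFourier i.1 y else 0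

lemma freqBall_mono {N M : ℕ} (h : N ≤ M) : freqBall N ⊆ freqBall M := by
  intro n hn
  simp only [freqBall, Finset.mem_filter, Fintype.mem_piFinset, Finset.mem_Icc] at hn ⊢
  have h' : (N : ℤ) ≤ M := by exact_mod_cast h
  refine ⟨fun i => ⟨by linarith [(hn.1 i).1], by linarith [(hn.1 i).2]⟩, hn.2.trans ?_⟩
  exact pow_le_pow_left₀ (by positivity) h' 2

lemma sum_freqBall_ite {E : Type*} [AddCommMonoid E] {N M : ℕ} (h : N ≤ M) (f : Freq → E) :
    ∑ n : freqBall M, (if (n : Freq) ∈ freqBall N then f n else 0) = ∑ n ∈ freqBall N, f n := by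
  rw [Finset.sum_coe_sort (freqBall M) fun n => if n ∈ freqBall N then f n else 0,
    ← Finset.sum_filter, Finset.filter_mem_eq_inter, Finset.inter_eq_right.2 (freqBall_mono h)]

lemma truncation_eq_sum {s : ℝ} {N M : ℕ} (h : N ≤ M) (u : Hs s) (y : UnitAddTorus (Fin 2)) :
    truncation N u y = ∑ i, fieldCoeff M N y i * gaussCoord M u i := by
  rw [truncation, ← sum_freqBall_ite h, Fintype.sum_prod_type]
  refine Finset.sum_congr rfl fun n _ => ?_
  simp only [fieldCoeff]
  split_ifs
  · rw [← sum_coordCoeff_mul_gaussCoord M u n, Finset.sum_mul]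
    exact Finset.sum_congr rfl fun b _ => by ring
  · simp

lemma norm_mFourier_apply (n : Freq) (y : UnitAddTorus (Fin 2)) :
    ‖UnitAddTorus.mFourier n y‖ = 1 := by
  simp [UnitAddTorus.mFourier, Fin.prod_univ_two, Circle.norm_coe]

/-- The two coordinates at n carry the coefficients e/t and ie/t with |e| = 1, a rotation scaled by
1/t. Hence real and imaginary parts of the field are uncorrelated with equal variance at every point
of the torus. -/
lemma sum_bool_fieldCoeff (M N : ℕ) (y : UnitAddTorus (Fin 2)) (n : freqBall M) :
    (∑ b, (fieldCoeff M N y (n, b)).re * (fieldCoeff M N y (n, b)).re =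
      if (n : Freq) ∈ freqBall N then 1 / bracketSq n / 2 else 0) ∧
    (∑ b, (fieldCoeff M N y (n, b)).im * (fieldCoeff M N y (n, b)).im =
      if (n : Freq) ∈ freqBall N then 1 / bracketSq n / 2 else 0) ∧
    ∑ b, (fieldCoeff M N y (n, b)).re * (fieldCoeff M N y (n, b)).im = 0 := by
  by_cases h : (n : Freq) ∈ freqBall N
  · have h1 := norm_mFourier_apply n y
    set e := UnitAddTorus.mFourier (n : Freq) y
    have h2 : e.re * e.re + e.im * e.im = 1 := by
      have := Complex.normSq_apply e
      rw [Complex.normSq_eq_norm_sq, h1] at this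
      linarith
    set t := Real.sqrt 2 * Real.sqrt (bracketSq n) with ht
    have h3 : t ^ 2 = 2 * bracketSq n := by
      rw [ht, mul_pow, Real.sq_sqrt (by norm_num), Real.sq_sqrt (bracketSq_pos _).le]
    have ht0 : t ≠ 0 := (sqrt_two_mul_pos n).ne'
    have hb := (bracketSq_pos n).ne'
    have e1 : fieldCoeff M N y (n, true) = ((t⁻¹ : ℝ) : ℂ) * (Complex.I * e) := by
      simp only [fieldCoeff, h, if_true, coordCoeff]
      rw [← ht, Complex.ofReal_inv]; ring
    have e2 : fieldCoeff M N y (n, false) = ((t⁻¹ : ℝ) : ℂ) * e := by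
      simp only [fieldCoeff, h, if_true, coordCoeff, Bool.false_eq_true, if_false]
      rw [← ht, Complex.ofReal_inv]; ring
    have h4 : 1 / bracketSq n / 2 = t⁻¹ ^ 2 := by
      rw [inv_pow, h3]; field_simp
    simp only [Fintype.sum_bool, e1, e2, Complex.re_ofReal_mul, Complex.im_ofReal_mul,
      Complex.I_mul_re, Complex.I_mul_im, if_pos h, h4]
    refine ⟨?_, ?_, ?_⟩
    · linear_combination t⁻¹ ^ 2 * h2
    · linear_combination t⁻¹ ^ 2 * h2
    · ring
  · simp [fieldCoeff, h]

lemma sigma_pos (N : ℕ) : 0 < sigma N := by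
  refine Finset.sum_pos (fun n _ => one_div_pos.2 (bracketSq_pos n)) ⟨0, ?_⟩
  simp [freqBall]

/-- The signed sum `∑ (-1)^j n_j` of the frequencies of a multi-index. -/
def altSum {k : ℕ} (n : Fin k → Freq) : Freq :=
  ∑ j : Fin k, if Even (j : ℕ) then n j else -n j

/-- The coefficient of a multi-index in the `n`-th Fourier coefficient of the nonlinearity. -/
def kernelCoeff (M N k : ℕ) (n : Freq) (ν : Fin k → freqBall M × Bool) : ℂ :=
  if n ∈ freqBall N ∧ (∀ j, ((ν j).1 : Freq) ∈ freqBall N) ∧ altSum (fun j => (ν j).1) = n then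
    ∏ j : Fin k, (if Even (j : ℕ) then coordCoeff (ν j).1 (ν j).2
      else starRingEnd ℂ (coordCoeff (ν j).1 (ν j).2))
  else 0

lemma mFourier_sum {α : Type*} (t : Finset α) (n : α → Freq) (y : UnitAddTorus (Fin 2)) :
    UnitAddTorus.mFourier (∑ j ∈ t, n j) y = ∏ j ∈ t, UnitAddTorus.mFourier (n j) y := by
  classical
  induction t using Finset.induction_on with
  | empty => simp [UnitAddTorus.mFourier_zero]
  | insert a t ha ih => rw [Finset.sum_insert ha, Finset.prod_insert ha, UnitAddTorus.mFourier_add, ih]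

/-- The normalised Haar measure of the torus. -/
def torusMeasure : Measure (UnitAddTorus (Fin 2)) := Measure.pi fun _ => AddCircle.haarAddCircle

instance instIsProbabilityMeasureTorus : IsProbabilityMeasure torusMeasure := by
  unfold torusMeasure; infer_instance

lemma mFourierCoeff_eq_integral_torusMeasure (f : UnitAddTorus (Fin 2) → ℂ) (n : Freq) :
    UnitAddTorus.mFourierCoeff f n = ∫ y, UnitAddTorus.mFourier (-n) y * f y ∂torusMeasure := rfl

lemma integral_mFourier (n : Freq) :
    ∫ y, UnitAddTorus.mFourier n y ∂torusMeasure = if n = 0 then (1 : ℂ) else 0 := by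
  have h := (orthonormal_iff_ite.1 (UnitAddTorus.orthonormal_mFourier (d := Fin 2))) 0 n
  rw [MeasureTheory.L2.inner_def] at h
  simp only [eq_comm (a := n)]
  rw [← h]
  refine integral_congr_ae ?_
  filter_upwards [UnitAddTorus.coeFn_mFourierLp 2 (0 : Freq), UnitAddTorus.coeFn_mFourierLp 2 n]
    with y h0 h1
  rw [h0, h1]
  simp [UnitAddTorus.mFourier_zero]

lemma prod_fieldCoeff {M N k : ℕ} (ν : Fin k → freqBall M × Bool) (y : UnitAddTorus (Fin 2)) :
    ∏ j : Fin k, (if Even (j : ℕ) then fieldCoeff M N y (ν j)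
      else starRingEnd ℂ (fieldCoeff M N y (ν j))) =
    (if ∀ j, ((ν j).1 : Freq) ∈ freqBall N then
      ∏ j : Fin k, (if Even (j : ℕ) then coordCoeff (ν j).1 (ν j).2
        else starRingEnd ℂ (coordCoeff (ν j).1 (ν j).2)) else 0) *
      UnitAddTorus.mFourier (altSum fun j => (ν j).1) y := by
  split_ifs with h
  · rw [altSum, mFourier_sum, ← Finset.prod_mul_distrib]
    refine Finset.prod_congr rfl fun j _ => ?_
    split_ifs
    · simp [fieldCoeff, h j]
    · simp [fieldCoeff, h j, UnitAddTorus.mFourier_neg]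
  · push Not at h
    obtain ⟨j, hj⟩ := h
    rw [zero_mul]
    refine Finset.prod_eq_zero (Finset.mem_univ j) ?_
    simp [fieldCoeff, hj]

/-- Integration over the torus keeps only the multi-indices of alternating sum n. A cutoff M ≥ N for
the coordinates is allowed so that two truncations can be subtracted coefficientwise. -/
lemma nonlinCoeff_eq_wickVal {m : ℕ} (hm : 1 ≤ m) {s : ℝ} {N M : ℕ} (h : N ≤ M) (u : Hs s)
    (n : Freq) :
    nonlinCoeff m N u n = wickVal (kernelCoeff M N (2 * (m - 1) + 1) n) (gaussCoord M u) := by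
  by_cases hn : n ∈ freqBall N
  · rw [nonlinCoeff, if_pos hn]
    have h1 : ∀ y, wickMonomial m (sigma N) (truncation N u y) =
        wickVal (fun ν : Fin (2 * (m - 1) + 1) → freqBall M × Bool =>
          ∏ j : Fin (2 * (m - 1) + 1), (if Even (j : ℕ) then fieldCoeff M N y (ν j)
            else starRingEnd ℂ (fieldCoeff M N y (ν j)))) (gaussCoord M u) := fun y => by
      rw [truncation_eq_sum h]
      have hh := sum_bool_fieldCoeff M N y
      have hs : ∑ n : freqBall M, (if (n : Freq) ∈ freqBall N then 1 / bracketSq n / 2 else 0)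
          = sigma N / 2 := by
        rw [sum_freqBall_ite h fun n => 1 / bracketSq n / 2, sigma, Finset.sum_div]
      exact wickMonomial_eq_wickVal hm (fieldCoeff M N y) (gaussCoord M u) (sigma_pos N)
        (by rw [Fintype.sum_prod_type, ← hs]
            exact Finset.sum_congr rfl fun n _ => (hh n).1)
        (by rw [Fintype.sum_prod_type, ← hs]
            exact Finset.sum_congr rfl fun n _ => (hh n).2.1)
        (by rw [Fintype.sum_prod_type]
            exact Finset.sum_eq_zero fun n _ => (hh n).2.2)
    have h2 : ∀ y, UnitAddTorus.mFourier (-n) y * wickMonomial m (sigma N) (truncation N u y) =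
        ∑ ν : Fin (2 * (m - 1) + 1) → freqBall M × Bool,
          ((if ∀ j, ((ν j).1 : Freq) ∈ freqBall N then
            ∏ j : Fin (2 * (m - 1) + 1), (if Even (j : ℕ) then coordCoeff (ν j).1 (ν j).2
              else starRingEnd ℂ (coordCoeff (ν j).1 (ν j).2)) else 0) *
            (MvPolynomial.eval (gaussCoord M u) (wick (∏ j, MvPolynomial.X (ν j))) : ℝ)) *
            UnitAddTorus.mFourier ((altSum fun j => (ν j).1) + -n) y := by
      intro y
      rw [h1, wickVal, Finset.mul_sum]
      refine Finset.sum_congr rfl fun ν _ => ?_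
      rw [prod_fieldCoeff, UnitAddTorus.mFourier_add]
      ring
    rw [mFourierCoeff_eq_integral_torusMeasure]
    simp_rw [h2]
    rw [integral_finsetSum]
    · rw [wickVal]
      refine Finset.sum_congr rfl fun ν _ => ?_
      rw [integral_const_mul, integral_mFourier, kernelCoeff]
      by_cases ha : altSum (fun j => ((ν j).1 : Freq)) = n
      · simp [ha, hn]
      · have : ¬ (altSum fun j => ((ν j).1 : Freq)) + -n = 0 := by
          rwa [← sub_eq_add_neg, sub_eq_zero]
        simp [ha, this]
    · intro ν _
      refine Integrable.const_mul ?_ _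
      exact (UnitAddTorus.mFourier _).continuous.integrable_of_hasCompactSupport
        (HasCompactSupport.of_compactSpace _)
  · simp [nonlinCoeff, hn, kernelCoeff, wickVal]

end FourierCoefficients

/-! ### Convolution estimates on the lattice -/

section Convolution

lemma one_le_bracketSq (n : Freq) : 1 ≤ bracketSq n := by
  unfold bracketSq; nlinarith [sq_nonneg (n 0 : ℝ), sq_nonneg (n 1 : ℝ)]

/-- `n` or `-n`, according to the sign. -/
def signed (b : Bool) (n : Freq) : Freq := if b then n else -n

lemma bracketSq_le_add (b : Bool) (m n : Freq) :
    bracketSq m ≤ 2 * (bracketSq (m + signed b n) + bracketSq n) := by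
  cases b <;>
  · simp only [signed, bracketSq, if_true, Bool.false_eq_true, if_false, Pi.add_apply, Pi.neg_apply,
      Int.cast_add, Int.cast_neg]
    nlinarith [sq_nonneg ((m 0 : ℝ) + 2 * n 0), sq_nonneg ((m 1 : ℝ) + 2 * n 1),
      sq_nonneg ((m 0 : ℝ) - 2 * n 0), sq_nonneg ((m 1 : ℝ) - 2 * n 1)]

lemma bracketSq_rpow_le_add {a : ℝ} (ha : 0 ≤ a) (ha1 : a ≤ 1) (b : Bool) (m n : Freq) :
    bracketSq m ^ a ≤ 2 * (bracketSq (m + signed b n) ^ a + bracketSq n ^ a) := by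
  have h1 := bracketSq_pos (m + signed b n)
  have h2 := bracketSq_pos n
  calc bracketSq m ^ a ≤ (2 * (bracketSq (m + signed b n) + bracketSq n)) ^ a :=
        Real.rpow_le_rpow (bracketSq_pos m).le (bracketSq_le_add b m n) ha
    _ = 2 ^ a * (bracketSq (m + signed b n) + bracketSq n) ^ a :=
        Real.mul_rpow (by norm_num) (by positivity)
    _ ≤ 2 ^ (1 : ℝ) * (bracketSq (m + signed b n) ^ a + bracketSq n ^ a) := by
        refine mul_le_mul ?_ (Real.rpow_add_le_add_rpow h1.le h2.le ha ha1) (by positivity)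
          (by positivity)
        exact Real.rpow_le_rpow_of_exponent_le (by norm_num) ha1
    _ = _ := by rw [Real.rpow_one]

/-- Replace the larger of x and y by the smaller. -/
lemma rpow_neg_mul_rpow_neg_le {x y p r : ℝ} (hx : 0 < x) (hy : 0 < y) (hp : 0 ≤ p) (hr : 0 ≤ r) :
    x ^ (-p) * y ^ (-r) ≤ x ^ (-(p + r)) + y ^ (-(p + r)) := by
  have hx' : 0 ≤ x ^ (-(p + r)) := (Real.rpow_pos_of_pos hx _).le
  have hy' : 0 ≤ y ^ (-(p + r)) := (Real.rpow_pos_of_pos hy _).le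
  rcases le_total x y with h | h
  · have h1 : y ^ (-r) ≤ x ^ (-r) := Real.rpow_le_rpow_of_nonpos hx h (by linarith)
    have h2 := mul_le_mul_of_nonneg_left h1 (Real.rpow_pos_of_pos hx (-p)).le
    rw [← Real.rpow_add hx, ← neg_add] at h2
    linarith
  · have h1 : x ^ (-p) ≤ y ^ (-p) := Real.rpow_le_rpow_of_nonpos hy h (by linarith)
    have h2 := mul_le_mul_of_nonneg_right h1 (Real.rpow_pos_of_pos hy (-r)).le
    rw [← Real.rpow_add hy, ← neg_add] at h2
    linarith

lemma sum_comp_le_tsum {f : Freq → ℝ} (hf : Summable f) (hf0 : ∀ n, 0 ≤ f n) (B : Finset Freq)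
    {g : Freq → Freq} (hg : Function.Injective g) : ∑ n : B, f (g n) ≤ ∑' n, f n := by
  classical
  rw [Finset.sum_coe_sort B fun n => f (g n), ← Finset.sum_image fun x _ y _ h => hg h]
  exact hf.sum_le_tsum _ fun n _ => hf0 n

lemma signed_injective (b : Bool) : Function.Injective (signed b) := by
  cases b
  · exact fun x y h => neg_injective (by simpa [signed] using h)
  · exact fun x y h => by simpa [signed] using h

/-- Exponents refer to ⟨n⟩², so summability on ℤ² begins beyond 1. After multiplying by ⟨m⟩^{2a} and
distributing it over m ± n and n, both terms have total exponent 1 + δ and are dominated by two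
summable functions. -/
lemma exists_sum_conv_le {a e δ : ℝ} (ha : 0 ≤ a) (he : 0 ≤ e) (hδ : 0 < δ) (hae : a + e ≤ 1) :
    ∃ C : ℝ, 0 < C ∧ ∀ (B : Finset Freq) (b : Bool) (m : Freq),
      ∑ n : B, bracketSq (m + signed b n) ^ (-(a + e + δ)) * bracketSq n ^ (-1 + e) ≤
        C * bracketSq m ^ (-a) := by
  have hsum : Summable fun n : Freq => bracketSq n ^ (-(1 + δ)) := by
    have := summable_bracketSq (s := -δ) (by linarith)
    simpa [neg_add, sub_eq_add_neg, add_comm] using this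
  have h0 : ∀ n : Freq, 0 ≤ bracketSq n ^ (-(1 + δ)) := fun n =>
    (Real.rpow_pos_of_pos (bracketSq_pos n) _).le
  have hZ : 0 ≤ ∑' n : Freq, bracketSq n ^ (-(1 + δ)) := tsum_nonneg h0
  refine ⟨8 * (∑' n : Freq, bracketSq n ^ (-(1 + δ))) + 1, by linarith, fun B b m => ?_⟩
  have hterm : ∀ n : Freq,
      bracketSq (m + signed b n) ^ (-(a + e + δ)) * bracketSq n ^ (-1 + e) ≤
      (4 * (bracketSq (m + signed b n) ^ (-(1 + δ)) + bracketSq n ^ (-(1 + δ)))) *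
        bracketSq m ^ (-a) := by
    intro n
    have hx := bracketSq_pos (m + signed b n)
    have hy := bracketSq_pos n
    have hm := bracketSq_pos m
    have h1 := bracketSq_rpow_le_add ha (by linarith) b m n
    set x := bracketSq (m + signed b n)
    set y := bracketSq n
    rw [Real.rpow_neg hm.le, ← div_eq_mul_inv, le_div_iff₀ (Real.rpow_pos_of_pos hm _)]
    have hxy : 0 < x ^ (-(a + e + δ)) * y ^ (-1 + e) :=
      mul_pos (Real.rpow_pos_of_pos hx _) (Real.rpow_pos_of_pos hy _)
    refine (mul_le_mul_of_nonneg_left h1 hxy.le).trans ?_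
    have e1 : x ^ (-(a + e + δ)) * y ^ (-1 + e) * x ^ a = x ^ (-(e + δ)) * y ^ (-(1 - e)) := by
      rw [mul_right_comm, ← Real.rpow_add hx]
      congr 2 <;> ring
    have e2 : x ^ (-(a + e + δ)) * y ^ (-1 + e) * y ^ a =
        x ^ (-(a + e + δ)) * y ^ (-(1 - e - a)) := by
      rw [mul_assoc, ← Real.rpow_add hy]
      congr 2; ring
    have h2 := rpow_neg_mul_rpow_neg_le hx hy (by linarith : 0 ≤ e + δ) (by linarith : 0 ≤ 1 - e)
    have h3 := rpow_neg_mul_rpow_neg_le hx hy (by linarith : 0 ≤ a + e + δ)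
      (by linarith : 0 ≤ 1 - e - a)
    rw [show e + δ + (1 - e) = 1 + δ by ring] at h2
    rw [show a + e + δ + (1 - e - a) = 1 + δ by ring] at h3
    linarith
  refine (Finset.sum_le_sum fun (n : B) _ => hterm n).trans ?_
  rw [← Finset.sum_mul, ← Finset.mul_sum, Finset.sum_add_distrib]
  refine mul_le_mul_of_nonneg_right ?_ (Real.rpow_pos_of_pos (bracketSq_pos m) _).le
  have h1 := sum_comp_le_tsum hsum h0 B (g := fun n => m + signed b n)
    fun x y h => signed_injective b (add_left_cancel h)
  have h2 := sum_comp_le_tsum hsum h0 B (g := id) Function.injective_id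
  simp only [id] at h2
  linarith

/-- With n_0 frozen and absorbed into m, the inductive bound for the other frequencies leaves the
exponent a + e_0 + δ, exactly what one more convolution reduces to a. -/
lemma exists_sum_iterated_conv_le {δ : ℝ} (hδ : 0 < δ) (k : ℕ) (e : Fin k → ℝ) (he : ∀ j, 0 ≤ e j)
    (a : ℝ) (ha : 0 ≤ a) (hae : a + ∑ j, e j + k * δ ≤ 1) (b : Fin k → Bool) :
    ∃ C : ℝ, 0 < C ∧ ∀ (B : Finset Freq) (m : Freq),
      ∑ n : Fin k → B, bracketSq (m + ∑ j, signed (b j) (n j)) ^ (-(a + ∑ j, e j + k * δ)) *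
        ∏ j, bracketSq (n j) ^ (-1 + e j) ≤ C * bracketSq m ^ (-a) := by
  induction k generalizing a with
  | zero => exact ⟨1, one_pos, fun B m => by simp⟩
  | succ k ih =>
    rw [Fin.sum_univ_succ] at hae
    push_cast at hae
    have hs : 0 ≤ ∑ j : Fin k, e j.succ := Finset.sum_nonneg fun j _ => he _
    have hk : 0 ≤ (k : ℝ) * δ := by positivity
    have he0 := he 0
    obtain ⟨C₁, hC₁, h₁⟩ := ih (fun j => e j.succ) (fun j => he _) (a + e 0 + δ) (by linarith)
      (by linarith) fun j => b j.succ
    obtain ⟨C₂, hC₂, h₂⟩ := exists_sum_conv_le ha he0 hδ (by linarith)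
    refine ⟨C₁ * C₂, by positivity, fun B m => ?_⟩
    rw [← (Fin.consEquiv fun _ => B).sum_comp, Fintype.sum_prod_type]
    have e1 : ∀ n0 : B, ∑ n : Fin k → B,
        bracketSq (m + ∑ j, signed (b j) ((Fin.consEquiv fun _ => B) (n0, n) j)) ^
            (-(a + ∑ j, e j + ((k + 1 : ℕ) : ℝ) * δ)) *
          ∏ j, bracketSq ((Fin.consEquiv fun _ => B) (n0, n) j) ^ (-1 + e j) ≤
        C₁ * (bracketSq (m + signed (b 0) n0) ^ (-(a + e 0 + δ)) * bracketSq n0 ^ (-1 + e 0)) := by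
      intro n0
      have h3 := mul_le_mul_of_nonneg_right (h₁ B (m + signed (b 0) n0))
        (Real.rpow_pos_of_pos (bracketSq_pos (n0 : Freq)) (-1 + e 0)).le
      rw [Finset.sum_mul] at h3
      refine le_trans (le_of_eq (Finset.sum_congr rfl fun n _ => ?_)) (h3.trans (le_of_eq ?_))
      · rw [Fin.sum_univ_succ, Fin.prod_univ_succ, Fin.sum_univ_succ (f := e)]
        simp only [Fin.consEquiv_apply, Fin.cons_zero, Fin.cons_succ]
        rw [← add_assoc m]
        push_cast
        rw [show a + (e 0 + ∑ j : Fin k, e j.succ) + (k + 1) * δ =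
          a + e 0 + δ + ∑ j : Fin k, e j.succ + k * δ by ring]
        ring
      · ring
    refine (Finset.sum_le_sum fun n0 _ => e1 n0).trans ?_
    rw [← Finset.mul_sum, mul_assoc]
    exact mul_le_mul_of_nonneg_left (h₂ B (b 0) m) hC₁.le

end Convolution

/-! ### The size of the coefficients of the nonlinearity -/

section KernelBound

lemma mem_freqBall {N : ℕ} {n : Freq} : n ∈ freqBall N ↔ bracketSq n ≤ 1 + (N : ℝ) ^ 2 := by
  have h1 : bracketSq n ≤ 1 + (N : ℝ) ^ 2 ↔ n 0 ^ 2 + n 1 ^ 2 ≤ (N : ℤ) ^ 2 := by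
    rw [bracketSq, add_le_add_iff_left]
    exact_mod_cast Iff.rfl
  rw [h1, freqBall, Finset.mem_filter, and_iff_right_iff_imp]
  intro h
  have hN : (0 : ℤ) ≤ N := by positivity
  simp only [Fintype.mem_piFinset, Finset.mem_Icc]
  intro i
  refine abs_le.1 (abs_le_of_sq_le_sq ?_ hN)
  fin_cases i
  · simp only [Fin.zero_eta]; nlinarith [sq_nonneg (n 1)]
  · simp only [Fin.mk_one]; nlinarith [sq_nonneg (n 0)]

lemma altSum_eq_sum_signed {k : ℕ} (n : Fin k → Freq) :
    altSum n = ∑ j : Fin k, signed (decide (Even (j : ℕ))) (n j) := by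
  refine Finset.sum_congr rfl fun j _ => ?_
  simp [signed]

lemma bracketSq_altSum_le {k : ℕ} (n : Fin k → Freq) :
    bracketSq (altSum n) ≤ 1 + k * ∑ j, (bracketSq (n j) - 1) := by
  have h : ∀ i, ((altSum n i : ℤ) : ℝ) ^ 2 ≤ k * ∑ j, (n j i : ℝ) ^ 2 := by
    intro i
    have h1 : ((altSum n i : ℤ) : ℝ) = ∑ j : Fin k, if Even (j : ℕ) then (n j i : ℝ) else -n j i := by
      rw [altSum, Finset.sum_apply, Int.cast_sum]
      refine Finset.sum_congr rfl fun j _ => ?_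
      split_ifs <;> simp
    rw [h1]
    refine sq_sum_le_card_mul_sum_sq.trans (le_of_eq ?_)
    rw [Finset.card_univ, Fintype.card_fin]
    congr 1
    refine Finset.sum_congr rfl fun j _ => ?_
    split_ifs <;> ring
  have h2 : ∑ j, (bracketSq (n j) - 1) = ∑ j, (n j 0 : ℝ) ^ 2 + ∑ j, (n j 1 : ℝ) ^ 2 := by
    rw [← Finset.sum_add_distrib]
    exact Finset.sum_congr rfl fun j _ => by rw [bracketSq]; ring
  rw [h2, bracketSq, mul_add]
  linarith [h 0, h 1]

/-- A large alternating sum forces a large input, so N² ≤ k ∑ ⟨n_j⟩² in either case; subadditivity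
of x ↦ x^ε and k^ε ≤ k then give the claim. -/
lemma rpow_le_of_not_mem {k N : ℕ} (hk : 1 ≤ k) {ε : ℝ} (hε : 0 < ε) (hε1 : ε < 1)
    (n : Fin k → Freq) (h : ¬ (altSum n ∈ freqBall N ∧ ∀ j, n j ∈ freqBall N)) :
    ((N : ℝ) ^ ε) ^ 2 ≤ k * ∑ j, bracketSq (n j) ^ ε := by
  have hk' : (1 : ℝ) ≤ k := by exact_mod_cast hk
  have hpos : ∀ j, 0 ≤ bracketSq (n j) - 1 := fun j => by linarith [one_le_bracketSq (n j)]
  have hS : ∑ j, (bracketSq (n j) - 1) ≤ ∑ j, bracketSq (n j) :=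
    Finset.sum_le_sum fun j _ => by linarith
  have h1 : (N : ℝ) ^ 2 ≤ k * ∑ j, bracketSq (n j) := by
    rw [not_and_or] at h
    rcases h with h | h
    · rw [mem_freqBall, not_le] at h
      have := bracketSq_altSum_le n
      nlinarith
    · push Not at h
      obtain ⟨j, hj⟩ := h
      rw [mem_freqBall, not_le] at hj
      have h3 : bracketSq (n j) ≤ ∑ j, bracketSq (n j) :=
        Finset.single_le_sum (f := fun j => bracketSq (n j)) (fun j _ => (bracketSq_pos _).le)
          (Finset.mem_univ j)
      have h4 : 0 ≤ ∑ j, bracketSq (n j) := Finset.sum_nonneg fun j _ => (bracketSq_pos _).le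
      nlinarith
  have h2 : ((N : ℝ) ^ ε) ^ 2 = ((N : ℝ) ^ 2) ^ ε := by
    rw [← Real.rpow_natCast, ← Real.rpow_natCast, ← Real.rpow_mul (by positivity),
      ← Real.rpow_mul (by positivity), mul_comm]
  have hnn : 0 ≤ ∑ j, bracketSq (n j) := Finset.sum_nonneg fun j _ => (bracketSq_pos _).le
  have hadd : ∀ t : Finset (Fin k), (∑ j ∈ t, bracketSq (n j)) ^ ε ≤ ∑ j ∈ t, bracketSq (n j) ^ ε := by
    intro t
    induction t using Finset.induction_on with
    | empty => simp [Real.zero_rpow hε.ne']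
    | insert j t hj ih =>
      rw [Finset.sum_insert hj, Finset.sum_insert hj]
      refine (Real.rpow_add_le_add_rpow (bracketSq_pos _).le
        (Finset.sum_nonneg fun j _ => (bracketSq_pos _).le) hε.le hε1.le).trans ?_
      linarith
  calc ((N : ℝ) ^ ε) ^ 2 = ((N : ℝ) ^ 2) ^ ε := h2
    _ ≤ (k * ∑ j, bracketSq (n j)) ^ ε := Real.rpow_le_rpow (by positivity) h1 hε.le
    _ = (k : ℝ) ^ ε * (∑ j, bracketSq (n j)) ^ ε := Real.mul_rpow (by positivity) hnn
    _ ≤ (k : ℝ) ^ (1 : ℝ) * ∑ j, bracketSq (n j) ^ ε := by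
        refine mul_le_mul (Real.rpow_le_rpow_of_exponent_le hk' hε1.le) (hadd _)
          (Real.rpow_nonneg hnn _) (by positivity)
    _ = _ := by rw [Real.rpow_one]

lemma norm_coordCoeff_sq (n : Freq) (b : Bool) :
    ‖coordCoeff n b‖ ^ 2 = 2⁻¹ * (bracketSq n)⁻¹ := by
  have h1 : ‖(if b then Complex.I else 1 : ℂ)‖ = 1 := by cases b <;> simp
  rw [coordCoeff, norm_div, h1, Complex.norm_real, Real.norm_of_nonneg (sqrt_two_mul_pos n).le,
    div_pow, mul_pow, Real.sq_sqrt (by norm_num), Real.sq_sqrt (bracketSq_pos n).le, one_pow,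
    one_div, mul_inv]

lemma norm_prod_coordCoeff_sq {M k : ℕ} (ν : Fin k → freqBall M × Bool) :
    ‖∏ j : Fin k, (if Even (j : ℕ) then coordCoeff (ν j).1 (ν j).2
      else starRingEnd ℂ (coordCoeff (ν j).1 (ν j).2))‖ ^ 2 =
      2⁻¹ ^ k * ∏ j, (bracketSq (ν j).1)⁻¹ := by
  rw [norm_prod, ← Finset.prod_pow]
  have h : ∀ j : Fin k, ‖(if Even (j : ℕ) then coordCoeff (ν j).1 (ν j).2
      else starRingEnd ℂ (coordCoeff (ν j).1 (ν j).2))‖ ^ 2 = 2⁻¹ * (bracketSq (ν j).1)⁻¹ := by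
    intro j
    split_ifs
    · exact norm_coordCoeff_sq _ _
    · rw [RCLike.norm_conj]; exact norm_coordCoeff_sq _ _
  rw [Finset.prod_congr rfl fun j _ => h j, Finset.prod_mul_distrib]
  simp

lemma norm_kernelCoeff_sub_sq_le {M N k : ℕ} (hNM : N ≤ M) (hN : 1 ≤ N) (hk : 1 ≤ k) {ε : ℝ}
    (hε : 0 < ε) (hε1 : ε < 1) (n : Freq) (ν : Fin k → freqBall M × Bool) :
    ‖kernelCoeff M M k n ν - kernelCoeff M N k n ν‖ ^ 2 ≤
      if altSum (fun j => ((ν j).1 : Freq)) = n then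
        2⁻¹ ^ k * (∏ j, (bracketSq (ν j).1)⁻¹) *
          ((k * ∑ j, bracketSq (ν j).1 ^ ε) * (1 / (N : ℝ) ^ ε) ^ 2) else 0 := by
  by_cases ha : altSum (fun j => ((ν j).1 : Freq)) = n
  swap
  · simp [kernelCoeff, ha]
  rw [if_pos ha]
  have hP : 0 ≤ 2⁻¹ ^ k * (∏ j, (bracketSq (ν j).1)⁻¹) := by
    rw [← norm_prod_coordCoeff_sq]; positivity
  have hNe : 0 < (N : ℝ) ^ ε := Real.rpow_pos_of_pos (by exact_mod_cast hN) _
  have hsum : 0 ≤ ∑ j, bracketSq (ν j).1 ^ ε :=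
    Finset.sum_nonneg fun j _ => (Real.rpow_pos_of_pos (bracketSq_pos _) _).le
  by_cases hin : n ∈ freqBall N ∧ ∀ j, ((ν j).1 : Freq) ∈ freqBall N
  · have hin' : n ∈ freqBall M ∧ ∀ j, ((ν j).1 : Freq) ∈ freqBall M :=
      ⟨freqBall_mono hNM hin.1, fun j => (ν j).1.2⟩
    rw [kernelCoeff, kernelCoeff, if_pos ⟨hin'.1, hin'.2, ha⟩, if_pos ⟨hin.1, hin.2, ha⟩]
    rw [sub_self, norm_zero, zero_pow two_ne_zero]
    exact mul_nonneg hP (by positivity)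
  · have h0 : kernelCoeff M N k n ν = 0 := by
      rw [kernelCoeff, if_neg]
      exact fun h => hin ⟨h.1, h.2.1⟩
    rw [h0, sub_zero]
    have h1 : ‖kernelCoeff M M k n ν‖ ^ 2 ≤ 2⁻¹ ^ k * ∏ j, (bracketSq (ν j).1)⁻¹ := by
      rw [kernelCoeff]
      split_ifs
      · rw [norm_prod_coordCoeff_sq]
      · simpa using hP
    refine h1.trans (le_mul_of_one_le_right hP ?_)
    have h2 := rpow_le_of_not_mem hk hε hε1 (fun j => ((ν j).1 : Freq)) (by rwa [ha])
    rw [div_pow, one_pow, mul_one_div, one_le_div (by positivity)]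
    exact h2

lemma sum_comp_fst {α β : Type*} [Fintype α] [Fintype β] (k : ℕ) (f : (Fin k → α) → ℝ) :
    ∑ ν : Fin k → α × β, f (fun j => (ν j).1) = (Fintype.card β : ℝ) ^ k * ∑ n, f n := by
  classical
  rw [← (Equiv.arrowProdEquivProdArrow (Fin k) (fun _ => α) (fun _ => β)).symm.sum_comp,
    Fintype.sum_prod_type, Finset.mul_sum]
  refine Finset.sum_congr rfl fun n _ => ?_
  simp [Equiv.arrowProdEquivProdArrow]

lemma exists_sum_altSum_le {s ε : ℝ} (hε : 0 < ε) (hε1 : ε < 1) (hsε : s + ε < 0) {k : ℕ}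
    (hk : 1 ≤ k) (i : Fin k) :
    ∃ C : ℝ, 0 < C ∧ ∀ B : Finset Freq, ∑ n : Fin k → B,
      bracketSq (altSum fun j => (n j : Freq)) ^ s * (∏ j, (bracketSq (n j))⁻¹) *
        bracketSq (n i) ^ ε ≤ C := by
  have hk' : (1 : ℝ) ≤ k := by exact_mod_cast hk
  -- The convolution bound needs total exponent at most 1, so decay beyond that is discarded. The
  -- gap a - ε > 0 is shared equally among the k summations.
  set a : ℝ := min (-s) 1 with ha
  have ha1 : a ≤ 1 := min_le_right _ _
  have has : a ≤ -s := min_le_left _ _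
  have haε : ε < a := lt_min (by linarith) hε1
  set δ := (a - ε) / k with hδ
  have hδ0 : 0 < δ := div_pos (by linarith) (by linarith)
  have hkδ : (k : ℝ) * δ = a - ε := by rw [hδ]; field_simp
  -- Only the i-th input carries the extra weight ⟨n_i⟩^{2ε}.
  let e : Fin k → ℝ := fun j => if j = i then ε else 0
  have hes : ∑ j, e j = ε := by simp [e]
  have htot : 0 + ∑ j, e j + k * δ = a := by rw [hes, hkδ]; ring
  obtain ⟨C, hC, h⟩ := exists_sum_iterated_conv_le hδ0 k e
    (fun j => by simp only [e]; split_ifs <;> linarith) 0 le_rfl (by rw [htot]; exact ha1)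
    fun j => decide (Even (j : ℕ))
  refine ⟨C, hC, fun B => ?_⟩
  have h1 := h B 0
  rw [htot] at h1
  have h2 : bracketSq (0 : Freq) ^ (-(0 : ℝ)) = 1 := by simp
  rw [h2, mul_one] at h1
  refine le_trans (Finset.sum_le_sum fun n _ => ?_) h1
  rw [zero_add, ← altSum_eq_sum_signed, mul_assoc]
  have h3 : (∏ j, (bracketSq (n j : Freq))⁻¹) * bracketSq (n i : Freq) ^ ε =
      ∏ j, bracketSq (n j : Freq) ^ (-1 + e j) := by
    have h4 : ∀ j, bracketSq (n j : Freq) ^ (-1 + e j) =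
        (bracketSq (n j : Freq))⁻¹ * if j = i then bracketSq (n j : Freq) ^ ε else 1 := by
      intro j
      rw [Real.rpow_add (bracketSq_pos _), Real.rpow_neg_one]
      congr 1
      simp only [e]
      split_ifs <;> simp
    rw [Finset.prod_congr rfl fun j _ => h4 j, Finset.prod_mul_distrib]
    simp
  rw [h3]
  refine mul_le_mul_of_nonneg_right ?_
    (Finset.prod_nonneg fun j _ => (Real.rpow_pos_of_pos (bracketSq_pos _) _).le)
  exact Real.rpow_le_rpow_of_exponent_le (one_le_bracketSq _) (by linarith)

/-- The rate of convergence of the coefficients of the truncated nonlinearity. -/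
lemma exists_sum_kernelCoeff_sub_le {s ε : ℝ} (hε : 0 < ε) (hε1 : ε < 1) (hsε : s + ε < 0) {k : ℕ}
    (hk : 1 ≤ k) :
    ∃ C : ℝ, 0 < C ∧ ∀ M N : ℕ, 1 ≤ N → N ≤ M →
      ∑ n : freqBall M, bracketSq n ^ s *
        ∑ ν, ‖kernelCoeff M M k n ν - kernelCoeff M N k n ν‖ ^ 2 ≤
      C * (1 / (N : ℝ) ^ ε) ^ 2 := by
  choose C hC h using exists_sum_altSum_le hε hε1 hsε hk
  have hk' : (0 : ℝ) < k := by exact_mod_cast hk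
  have hCs : 0 < ∑ i, C i := Finset.sum_pos (fun i _ => hC i) ⟨⟨0, hk⟩, Finset.mem_univ _⟩
  refine ⟨k * ∑ i, C i, by positivity, fun M N hN hNM => ?_⟩
  set r : ℝ := (1 / (N : ℝ) ^ ε) ^ 2 with hr
  let f : (Fin k → freqBall M) → ℝ := fun n => bracketSq (altSum fun j => (n j : Freq)) ^ s *
    (2⁻¹ ^ k * (∏ j, (bracketSq (n j))⁻¹) * ((k * ∑ j, bracketSq (n j) ^ ε) * r))
  have hf0 : ∀ n, 0 ≤ f n := fun n => by
    refine mul_nonneg (Real.rpow_pos_of_pos (bracketSq_pos _) _).le (mul_nonneg (mul_nonneg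
      (by positivity) (Finset.prod_nonneg fun j _ => (inv_pos.2 (bracketSq_pos _)).le))
      (mul_nonneg (mul_nonneg hk'.le (Finset.sum_nonneg fun j _ =>
        (Real.rpow_pos_of_pos (bracketSq_pos _) _).le)) (by positivity)))
  have h1 : ∑ n : freqBall M, bracketSq n ^ s *
        ∑ ν, ‖kernelCoeff M M k n ν - kernelCoeff M N k n ν‖ ^ 2 ≤
      ∑ n : freqBall M, ∑ ν : Fin k → freqBall M × Bool,
        if altSum (fun j => ((ν j).1 : Freq)) = n then f (fun j => (ν j).1) else 0 := by
    refine Finset.sum_le_sum fun n _ => ?_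
    rw [Finset.mul_sum]
    refine Finset.sum_le_sum fun ν _ => ?_
    refine (mul_le_mul_of_nonneg_left (norm_kernelCoeff_sub_sq_le hNM hN hk hε hε1 n ν)
      (Real.rpow_pos_of_pos (bracketSq_pos _) _).le).trans (le_of_eq ?_)
    split_ifs with ha
    · rw [← ha]
    · rw [mul_zero]
  refine h1.trans ?_
  rw [Finset.sum_comm]
  -- The alternating sum determines the output frequency, so at most one n contributes.
  have h2 : ∀ ν : Fin k → freqBall M × Bool, (∑ n : freqBall M,
      if altSum (fun j => ((ν j).1 : Freq)) = n then f (fun j => (ν j).1) else 0) ≤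
        f fun j => (ν j).1 := by
    intro ν
    rw [Finset.sum_coe_sort (freqBall M) fun n =>
      if altSum (fun j => ((ν j).1 : Freq)) = n then f (fun j => (ν j).1) else 0, Finset.sum_ite_eq]
    split_ifs
    · exact le_rfl
    · exact hf0 _
  refine (Finset.sum_le_sum fun ν _ => h2 ν).trans ?_
  rw [sum_comp_fst k f]
  have h3 : (Fintype.card Bool : ℝ) ^ k * ∑ n, f n = k * (∑ i, ∑ n : Fin k → freqBall M,
      bracketSq (altSum fun j => (n j : Freq)) ^ s * (∏ j, (bracketSq (n j))⁻¹) *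
        bracketSq (n i) ^ ε) * r := by
    rw [Finset.sum_comm, Finset.mul_sum, Finset.mul_sum, Finset.sum_mul]
    refine Finset.sum_congr rfl fun n _ => ?_
    -- The 2^k choices of real or imaginary part cancel the variances 1/2.
    have h4 : (2 : ℝ) ^ k * 2⁻¹ ^ k = 1 := by rw [← mul_pow]; norm_num
    simp only [f, Fintype.card_bool, Nat.cast_ofNat, ← Finset.mul_sum]
    linear_combination (bracketSq (altSum fun j => (n j : Freq)) ^ s *
      (∏ j, (bracketSq (n j))⁻¹) * ((k * ∑ j, bracketSq (n j) ^ ε) * r)) * h4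
  rw [h3]
  refine mul_le_mul_of_nonneg_right (mul_le_mul_of_nonneg_left ?_ hk'.le) (by positivity)
  exact Finset.sum_le_sum fun i _ => h i (freqBall M)

end KernelBound

/-! ### Gaussian integration by parts -/

section GaussianIBP

open MvPolynomial

lemma integrable_pow_gaussianReal (n : ℕ) : Integrable (fun x : ℝ => x ^ n) (gaussianReal 0 1) := by
  have h := (memLp_id_gaussianReal (μ := 0) (v := 1) (n : ℝ≥0)).integrable_norm_pow'
  refine (integrable_norm_iff (by fun_prop)).1 ?_
  simpa using h

lemma integrable_gaussianPDFReal_mul_pow (n : ℕ) :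
    Integrable (fun x : ℝ => gaussianPDFReal 0 1 x * x ^ n) := by
  have h := integrable_pow_gaussianReal n
  rw [gaussianReal_of_var_ne_zero _ one_ne_zero,
    integrable_withDensity_iff_integrable_smul' (measurable_gaussianPDF _ _)
      (ae_of_all _ fun _ => gaussianPDF_lt_top)] at h
  simpa [toReal_gaussianPDF] using h

lemma hasDerivAt_gaussianPDFReal (x : ℝ) :
    HasDerivAt (gaussianPDFReal 0 1) (-x * gaussianPDFReal 0 1 x) x := by
  rw [gaussianPDFReal_def]
  have h1 : HasDerivAt (fun x : ℝ => -(x - 0) ^ 2 / (2 * ((1 : ℝ≥0) : ℝ))) (-x) x := by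
    have := (((hasDerivAt_id x).sub_const 0).pow 2).neg.div_const (2 * ((1 : ℝ≥0) : ℝ))
    refine this.congr_deriv ?_
    simp only [NNReal.coe_one, id]
    norm_num
    ring
  refine (h1.exp.const_mul _).congr_deriv ?_
  ring

/-- Integration by parts against the density φ, using φ' = -xφ. At n = 0 the truncated exponent n -
1 is multiplied by 0. -/
lemma integral_pow_succ_gaussianReal (n : ℕ) :
    ∫ x, x ^ (n + 1) ∂gaussianReal 0 1 = n * ∫ x, x ^ (n - 1) ∂gaussianReal 0 1 := by
  rw [integral_gaussianReal_eq_integral_smul one_ne_zero,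
    integral_gaussianReal_eq_integral_smul one_ne_zero]
  have h := integral_mul_deriv_eq_deriv_mul_of_integrable
    (u := fun x : ℝ => x ^ n) (v := gaussianPDFReal 0 1) (u' := fun x => n * x ^ (n - 1))
    (v' := fun x => -x * gaussianPDFReal 0 1 x)
    (fun x _ => hasDerivAt_pow n x) (fun x _ => hasDerivAt_gaussianPDFReal x)
    ((integrable_gaussianPDFReal_mul_pow (n + 1)).neg.congr
      (ae_of_all _ fun x => by simp only [Pi.neg_apply, Pi.mul_apply]; ring))
    (((integrable_gaussianPDFReal_mul_pow (n - 1)).const_mul (n : ℝ)).congr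
      (ae_of_all _ fun x => by simp only [Pi.mul_apply]; ring))
    ((integrable_gaussianPDFReal_mul_pow n).congr
      (ae_of_all _ fun x => by simp only [Pi.mul_apply]; ring))
  have e1 : ∫ x : ℝ, gaussianPDFReal 0 1 x • x ^ (n + 1) =
      -∫ x : ℝ, x ^ n * (-x * gaussianPDFReal 0 1 x) := by
    rw [← integral_neg]
    exact integral_congr_ae (ae_of_all _ fun x => by simp only [smul_eq_mul]; ring)
  rw [e1, h, neg_neg, ← integral_const_mul]
  exact integral_congr_ae (ae_of_all _ fun x => by simp only [smul_eq_mul]; ring)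

variable {ι : Type} [Fintype ι]

lemma eval_monomial_one (d : ι →₀ ℕ) (x : ι → ℝ) : eval x (monomial d (1 : ℝ)) = ∏ i, x i ^ d i := by
  rw [eval_monomial, one_mul, Finsupp.prod_fintype _ _ fun i => pow_zero _]

lemma integral_eval_monomial (d : ι →₀ ℕ) :
    ∫ x, eval x (monomial d (1 : ℝ)) ∂(Measure.pi fun _ : ι => gaussianReal 0 1) =
      ∏ i, ∫ x, x ^ d i ∂gaussianReal 0 1 := by
  simp_rw [eval_monomial_one]
  exact integral_fintype_prod_eq_prod (𝕜 := ℝ) (fun i (x : ℝ) => x ^ d i)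

/-- By linearity it suffices to treat monomials, whose integrals factorise; only the i-th factor
changes, and there the one-dimensional moment recursion applies. -/
lemma isGaussianSystem_pi :
    IsGaussianSystem (Measure.pi fun _ : ι => gaussianReal 0 1) fun x => x := by
  classical
  have hint : ∀ P : MvPolynomial ι ℝ, Integrable (fun x : ι → ℝ => eval x P)
      (Measure.pi fun _ : ι => gaussianReal 0 1) := by
    intro P
    induction P using MvPolynomial.induction_on' with
    | add p q hp hq => simp only [map_add]; exact hp.add hq
    | monomial d a =>
      have h0 : monomial d a = a • monomial d (1 : ℝ) := by simp [smul_monomial]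
      simp only [h0, smul_eval, eval_monomial_one]
      exact (Integrable.fintype_prod (f := fun i (x : ℝ) => x ^ d i)
        fun i => integrable_pow_gaussianReal _).const_mul a
  refine ⟨hint, fun P i => ?_⟩
  induction P using MvPolynomial.induction_on' with
  | add p q hp hq =>
    simp only [map_add, mul_add]
    rw [integral_add (hint _) (hint _), integral_add (hint _) (hint _), hp, hq]
  | monomial d a =>
    have h0 : monomial d a = a • monomial d (1 : ℝ) := by simp [smul_monomial]
    have h1 : X i * monomial d (1 : ℝ) = monomial (d + Finsupp.single i 1) 1 := by
      rw [X, monomial_mul, mul_one, add_comm]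
    have h2 : pderiv i (monomial d (1 : ℝ)) =
        (d i : ℝ) • monomial (d - Finsupp.single i 1) (1 : ℝ) := by
      rw [pderiv_monomial, smul_monomial]; simp
    have h3 : ∀ j ∈ ({i}ᶜ : Finset ι), ∫ x, x ^ (d - Finsupp.single i 1 : ι →₀ ℕ) j ∂gaussianReal 0 1 =
        ∫ x, x ^ (d + Finsupp.single i 1 : ι →₀ ℕ) j ∂gaussianReal 0 1 := by
      intro j hj
      have : j ≠ i := by simpa using hj
      simp [Finsupp.single_eq_of_ne this]
    rw [h0, Derivation.map_smul, mul_smul_comm, h1, h2]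
    simp only [smul_eval]
    rw [integral_const_mul, integral_const_mul, integral_const_mul, integral_eval_monomial,
      integral_eval_monomial, Fintype.prod_eq_mul_prod_compl i, Fintype.prod_eq_mul_prod_compl i,
      Finset.prod_congr rfl h3]
    simp only [Finsupp.add_apply, Finsupp.tsub_apply, Finsupp.single_eq_same,
      integral_pow_succ_gaussianReal]
    ring

lemma IsGaussianSystem.of_map {Ω : Type} [MeasurableSpace Ω] {μ : Measure Ω} {x : Ω → ι → ℝ}
    (hx : AEMeasurable x μ) (h : μ.map x = Measure.pi fun _ : ι => gaussianReal 0 1) :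
    IsGaussianSystem μ x := by
  have hm : ∀ P : MvPolynomial ι ℝ, Measurable fun y : ι → ℝ => eval y P := fun P =>
    (MvPolynomial.continuous_eval P).measurable
  refine ⟨fun P => ?_, fun P i => ?_⟩
  · have h1 := (isGaussianSystem_pi (ι := ι)).integrable P
    rw [← h] at h1
    exact h1.comp_aemeasurable hx
  · have h1 := (isGaussianSystem_pi (ι := ι)).ibp P i
    rwa [← h, integral_map hx (hm _).aestronglyMeasurable,
      integral_map hx (hm _).aestronglyMeasurable] at h1

end GaussianIBP

/-! ### The Gaussian coordinates of the free field -/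

section FreeField

/-- The real and the imaginary part of `z`, normalised to variance `1`. -/
def stdCoord (z : ℂ) (b : Bool) : ℝ := Real.sqrt 2 * if b then z.im else z.re

lemma measurable_stdCoord : Measurable stdCoord := by
  refine measurable_pi_iff.2 fun b => ?_
  cases b
  · simpa [stdCoord] using Complex.measurable_re.const_mul _
  · simpa [stdCoord] using Complex.measurable_im.const_mul _

lemma map_stdCoord : stdComplexGaussian.map stdCoord = Measure.pi fun _ : Bool => gaussianReal 0 1 := by
  symm
  refine Measure.pi_eq fun t ht => ?_
  have hm : Measurable fun h : ℝ × ℝ => (⟨h.1, h.2⟩ : ℂ) :=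
    Complex.measurableEquivRealProd.symm.measurable
  have hg : (gaussianReal 0 (1 / 2)).map (Real.sqrt 2 * ·) = gaussianReal 0 1 := by
    rw [gaussianReal_map_const_mul, mul_zero]
    congr 1
    ext
    push_cast
    simp
  have ht' : MeasurableSet (Set.univ.pi t) := MeasurableSet.univ_pi ht
  rw [Measure.map_apply measurable_stdCoord ht', stdComplexGaussian,
    Measure.map_apply hm (measurable_stdCoord ht')]
  have hset : (fun h : ℝ × ℝ => (⟨h.1, h.2⟩ : ℂ)) ⁻¹' (stdCoord ⁻¹' Set.univ.pi t) =
      ((Real.sqrt 2 * ·) ⁻¹' t false) ×ˢ ((Real.sqrt 2 * ·) ⁻¹' t true) := by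
    ext h
    simp [stdCoord]
  rw [hset, Measure.prod_prod, Fintype.prod_bool, ← hg,
    Measure.map_apply (by fun_prop) (ht _), Measure.map_apply (by fun_prop) (ht _), mul_comm]

/-- A product over frequencies of products over two parts is one product over pairs; restricting it
along an injection from a finite index set gives the finite product. -/
lemma map_noiseLaw_stdCoord (M : ℕ) :
    noiseLaw.map (fun g (i : freqBall M × Bool) => stdCoord (g i.1) i.2) =
      Measure.pi fun _ : freqBall M × Bool => gaussianReal 0 1 := by
  have h1 : noiseLaw.map (fun g n => stdCoord (g n)) =
      Measure.infinitePi fun _ : Freq => Measure.infinitePi fun _ : Bool => gaussianReal 0 1 := by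
    rw [noiseLaw, Measure.infinitePi_map_pi _ fun _ => measurable_stdCoord]
    congr 1
    funext n
    rw [map_stdCoord, Measure.infinitePi_eq_pi]
  have h2 := Measure.infinitePi_map_curry_symm (fun (_ : Freq) (_ : Bool) => gaussianReal 0 1)
  have hinj : Function.Injective fun i : freqBall M × Bool => ((i.1 : Freq), i.2) := by
    rintro ⟨n, b⟩ ⟨n', b'⟩ h
    obtain ⟨h1, h2⟩ := Prod.mk.inj h
    exact Prod.ext (Subtype.ext h1) h2
  have h3 := Measure.map_infinitePi_infinitePi_of_inj
    (P := fun _ : Freq × Bool => gaussianReal 0 1) hinj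
  have hm : Measurable fun (g : Freq → ℂ) n => stdCoord (g n) :=
    measurable_pi_iff.2 fun n => measurable_stdCoord.comp (measurable_pi_apply n)
  rw [← h2, ← h1, Measure.map_map (MeasurableEquiv.measurable _) hm, Measure.map_map (by fun_prop)
    ((MeasurableEquiv.measurable _).comp hm), Measure.infinitePi_eq_pi] at h3
  rw [← h3]
  rfl

lemma gaussCoord_seriesCoeff (M : ℕ) (g : Freq → ℂ) (i : freqBall M × Bool) :
    gaussCoord M (seriesCoeff g) i = stdCoord (g i.1) i.2 := by
  have h : Real.sqrt (bracketSq i.1) ≠ 0 := (Real.sqrt_pos.2 (bracketSq_pos _)).ne'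
  rw [gaussCoord, stdCoord, seriesCoeff]
  split_ifs
  · rw [Complex.div_ofReal_im]; field_simp
  · rw [Complex.div_ofReal_re]; field_simp

/-! ### Coefficients and norm in H^s -/

lemma sobolevWeight_singleton (s : ℝ) (n : Freq) :
    sobolevWeight s {n} = ENNReal.ofReal (bracketSq n ^ s) := by
  rw [sobolevWeight, withDensity_apply _ (measurableSet_singleton n)]
  simp

lemma eq_of_ae_sobolevWeight {s : ℝ} {f g : Freq → ℂ} (h : f =ᵐ[sobolevWeight s] g) (n : Freq) :
    f n = g n := by
  by_contra hn
  have h1 : sobolevWeight s {n} = 0 := measure_mono_null (by simpa using hn) h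
  rw [sobolevWeight_singleton, ENNReal.ofReal_eq_zero] at h1
  exact absurd (Real.rpow_pos_of_pos (bracketSq_pos n) s) (not_lt.2 h1)

lemma norm_sq_eq_tsum {s : ℝ} (u : Hs s) :
    ENNReal.ofReal (‖u‖ ^ 2) = ∑' n, ENNReal.ofReal (bracketSq n ^ s * ‖u n‖ ^ 2) := by
  have h := edist_sq_toLp s u (Lp.memLp u) 0
  rw [Lp.toLp_coeFn, edist_zero_right] at h
  have h0 : ∀ n, (0 : Hs s) n = 0 := fun n => eq_of_ae_sobolevWeight (Lp.coeFn_zero _ _ _) n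
  simp only [h0, sub_zero] at h
  rw [ENNReal.ofReal_pow (norm_nonneg _), ofReal_norm, h, ← ENNReal.rpow_natCast,
    ← ENNReal.rpow_mul]
  norm_num
  refine tsum_congr fun n => ?_
  rw [ENNReal.ofReal_mul (Real.rpow_pos_of_pos (bracketSq_pos n) _).le,
    ENNReal.ofReal_pow (norm_nonneg _), ofReal_norm]

lemma norm_sq_eq_sum {s : ℝ} (u : Hs s) (B : Finset Freq) (h : ∀ n, n ∉ B → u n = 0) :
    ‖u‖ ^ 2 = ∑ n ∈ B, bracketSq n ^ s * ‖u n‖ ^ 2 := by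
  have h1 := norm_sq_eq_tsum u
  have h2 : ∀ n, 0 ≤ bracketSq n ^ s * ‖u n‖ ^ 2 := fun n =>
    mul_nonneg (Real.rpow_pos_of_pos (bracketSq_pos n) _).le (by positivity)
  rw [tsum_eq_sum (s := B) fun n hn => by simp [h n hn],
    ← ENNReal.ofReal_sum_of_nonneg fun n _ => h2 n,
    ENNReal.ofReal_eq_ofReal_iff (by positivity) (Finset.sum_nonneg fun n _ => h2 n)] at h1
  exact h1

lemma continuous_coeff {s : ℝ} (n : Freq) : Continuous fun u : Hs s => u n := by
  have hc : 0 < bracketSq n ^ s := Real.rpow_pos_of_pos (bracketSq_pos n) s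
  have key : ∀ u : Hs s, ‖u n‖ ≤ (Real.sqrt (bracketSq n ^ s))⁻¹ * ‖u‖ := by
    intro u
    have h1 : bracketSq n ^ s * ‖u n‖ ^ 2 ≤ ‖u‖ ^ 2 := by
      rw [← ENNReal.ofReal_le_ofReal_iff (by positivity), norm_sq_eq_tsum]
      exact ENNReal.le_tsum n
    rw [inv_mul_eq_div, le_div_iff₀ (Real.sqrt_pos.2 hc)]
    refine abs_le_of_sq_le_sq' ?_ (norm_nonneg u) |>.2
    rw [mul_pow, Real.sq_sqrt hc.le]
    linarith
  refine LipschitzWith.continuous (K := Real.toNNReal (Real.sqrt (bracketSq n ^ s))⁻¹)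
    (LipschitzWith.of_dist_le_mul fun u v => ?_)
  have h2 : (u - v : Hs s) n = u n - v n := eq_of_ae_sobolevWeight (Lp.coeFn_sub u v) n
  rw [dist_eq_norm, dist_eq_norm, ← h2, Real.coe_toNNReal _ (by positivity)]
  exact key _

lemma continuous_gaussCoord {s : ℝ} (M : ℕ) : Continuous fun u : Hs s => gaussCoord M u := by
  refine continuous_pi fun i => ?_
  unfold gaussCoord
  refine continuous_const.mul ?_
  split_ifs
  · exact Complex.continuous_im.comp (continuous_coeff _)
  · exact Complex.continuous_re.comp (continuous_coeff _)

/-- Under the Gaussian free field the normalised coordinates are independent standard Gaussians. -/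
lemma isGaussianSystem_gff {s : ℝ} (hs : s < 0) (M : ℕ) :
    IsGaussianSystem (gff s) fun u : Hs s => gaussCoord M u := by
  have hm := (continuous_gaussCoord (s := s) M).measurable
  refine IsGaussianSystem.of_map hm.aemeasurable ?_
  rw [gff, Measure.map_map hm (measurable_randomSeries s), ← map_noiseLaw_stdCoord]
  refine Measure.map_congr ?_
  filter_upwards [ae_memLp_seriesCoeff hs] with g hg
  have h1 : ∀ n, randomSeries s g n = seriesCoeff g n := by
    intro n
    rw [randomSeries, dif_pos hg]
    exact eq_of_ae_sobolevWeight hg.coeFn_toLp n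
  funext i
  rw [← gaussCoord_seriesCoeff]
  simp only [Function.comp, gaussCoord, h1]

end FreeField

/-! ### Moment bounds for the truncated nonlinearity -/

section MomentBounds

lemma F_apply (m N : ℕ) {s : ℝ} (u : Hs s) (n : Freq) : F m N u n = nonlinCoeff m N u n :=
  eq_of_ae_sobolevWeight (memLp_nonlinCoeff m N u).coeFn_toLp n

lemma continuous_wickVal {ι : Type} [Fintype ι] {k : ℕ} (c : (Fin k → ι) → ℂ) :
    Continuous (wickVal c) := by
  unfold wickVal
  exact continuous_finsetSum _ fun ν _ => continuous_const.mul
    (Complex.continuous_ofReal.comp (MvPolynomial.continuous_eval _))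

lemma wickVal_sub {ι : Type} [Fintype ι] {k : ℕ} (c d : (Fin k → ι) → ℂ) (x : ι → ℝ) :
    wickVal (c - d) x = wickVal c x - wickVal d x := by
  simp only [wickVal, Pi.sub_apply, sub_mul, Finset.sum_sub_distrib]

lemma sub_apply_Hs {s : ℝ} (u v : Hs s) (n : Freq) : (u - v : Hs s) n = u n - v n :=
  eq_of_ae_sobolevWeight (Lp.coeFn_sub u v) n

/-- Finitely many output coefficients are nonzero, each a polynomial in finitely many continuous
coordinates. This supplies the measurability needed for L^p. -/
lemma continuous_F {m : ℕ} (hm : 1 ≤ m) (N : ℕ) {s : ℝ} : Continuous fun u : Hs s => F m N u := by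
  refine continuous_iff_continuousAt.2 fun u => tendsto_iff_norm_sub_tendsto_zero.2 ?_
  have hc : ∀ n, Continuous fun v : Hs s => nonlinCoeff m N v n := fun n => by
    simp_rw [nonlinCoeff_eq_wickVal hm le_rfl]
    exact (continuous_wickVal _).comp (continuous_gaussCoord N)
  have h1 : ∀ v : Hs s, ‖F m N v - F m N u‖ = Real.sqrt (∑ n ∈ freqBall N,
      bracketSq n ^ s * ‖nonlinCoeff m N v n - nonlinCoeff m N u n‖ ^ 2) := by
    intro v
    rw [← Real.sqrt_sq (norm_nonneg (F m N v - F m N u)), norm_sq_eq_sum _ (freqBall N)]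
    · simp_rw [sub_apply_Hs, F_apply]
    · intro n hn
      rw [sub_apply_Hs, F_apply, F_apply]
      simp [nonlinCoeff, hn]
  simp_rw [h1]
  have h2 : Continuous fun v : Hs s => Real.sqrt (∑ n ∈ freqBall N,
      bracketSq n ^ s * ‖nonlinCoeff m N v n - nonlinCoeff m N u n‖ ^ 2) :=
    Real.continuous_sqrt.comp (continuous_finsetSum _ fun n _ =>
      continuous_const.mul (((hc n).sub continuous_const).norm.pow 2))
  simpa using h2.tendsto u

lemma eLpNorm_le_of_integral_pow_le {Ω E : Type*} [MeasurableSpace Ω] [NormedAddCommGroup E]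
    {μ : Measure Ω} {f : Ω → E} (q : ℕ) {A : ℝ} (hA : 0 ≤ A)
    (hint : Integrable (fun ω => (‖f ω‖ ^ 2) ^ (q + 1)) μ)
    (h : ∫ ω, (‖f ω‖ ^ 2) ^ (q + 1) ∂μ ≤ A ^ (q + 1)) :
    eLpNorm f ((2 * (q + 1) : ℕ) : ℝ≥0∞) μ ≤ ENNReal.ofReal (Real.sqrt A) := by
  rw [eLpNorm_eq_lintegral_rpow_enorm_toReal (by simp) (ENNReal.natCast_ne_top _)]
  have h1 : ∫⁻ ω, ‖f ω‖ₑ ^ ((2 * (q + 1) : ℕ) : ℝ≥0∞).toReal ∂μ =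
      ENNReal.ofReal (∫ ω, (‖f ω‖ ^ 2) ^ (q + 1) ∂μ) := by
    rw [ofReal_integral_eq_lintegral_ofReal hint (ae_of_all _ fun ω => by positivity)]
    refine lintegral_congr fun ω => ?_
    rw [ENNReal.toReal_natCast, ENNReal.rpow_natCast, ← pow_mul,
      ENNReal.ofReal_pow (norm_nonneg _), ofReal_norm]
  rw [h1, ENNReal.toReal_natCast]
  refine (ENNReal.rpow_le_rpow (ENNReal.ofReal_le_ofReal h) (by positivity)).trans (le_of_eq ?_)
  rw [ENNReal.ofReal_rpow_of_nonneg (by positivity) (by positivity), Real.sqrt_eq_rpow,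
    ← Real.rpow_natCast, ← Real.rpow_mul hA]
  congr 2
  push_cast
  field_simp

/-- The `L^{2(q+1)}` norm of a random element of `H^s` whose Fourier coefficients are Wick ordered
homogeneous polynomials of degree `k` in the Gaussian coordinates. -/
lemma eLpNorm_le_of_coeff_eq_wickVal {s : ℝ} (hs : s < 0) {M k : ℕ} (G : Hs s → Hs s)
    (κ : Freq → (Fin k → freqBall M × Bool) → ℂ)
    (hG : ∀ u, ∀ n ∈ freqBall M, G u n = wickVal (κ n) (gaussCoord M u))
    (hG0 : ∀ u, ∀ n ∉ freqBall M, G u n = 0) (q : ℕ) :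
    eLpNorm G ((2 * (q + 1) : ℕ) : ℝ≥0∞) (gff s) ≤
      ENNReal.ofReal (Real.sqrt ((2 * q + 1) ^ k * k.factorial *
        ∑ n : freqBall M, bracketSq n ^ s * ∑ ν, ‖κ n ν‖ ^ 2)) := by
  have hJ : ∀ n : Freq, 0 ≤ bracketSq n ^ s := fun n =>
    (Real.rpow_pos_of_pos (bracketSq_pos n) s).le
  -- Real and imaginary parts, with the Sobolev weight absorbed, turn the squared H^s norm into a
  -- finite sum of squares of real Wick polynomials.
  let c : freqBall M × Bool → (Fin k → freqBall M × Bool) → ℝ := fun a ν =>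
    Real.sqrt (bracketSq a.1 ^ s) * if a.2 then (κ a.1 ν).im else (κ a.1 ν).re
  have hc : ∀ (a : freqBall M × Bool) (x : freqBall M × Bool → ℝ),
      MvPolynomial.eval x (wick (tensorPoly (c a))) = Real.sqrt (bracketSq a.1 ^ s) *
        if a.2 then (wickVal (κ a.1) x).im else (wickVal (κ a.1) x).re := by
    rintro ⟨n, b⟩ x
    cases b <;>
      simp only [c, wickVal_im, wickVal_re, tensorPoly, map_sum, wick_C_mul, map_mul,
        MvPolynomial.eval_C, Finset.mul_sum, mul_assoc, if_true, Bool.false_eq_true, if_false]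
  have hnorm : ∀ u : Hs s, ‖G u‖ ^ 2 =
      ∑ a, MvPolynomial.eval (gaussCoord M u) (wick (tensorPoly (c a))) ^ 2 := by
    intro u
    rw [norm_sq_eq_sum (G u) (freqBall M) (hG0 u), ← Finset.sum_coe_sort, Fintype.sum_prod_type]
    refine Finset.sum_congr rfl fun n _ => ?_
    rw [hG u n n.2, Fintype.sum_bool, hc, hc]
    simp only [if_true, Bool.false_eq_true, if_false]
    rw [mul_pow, mul_pow, Real.sq_sqrt (hJ n), ← Complex.normSq_eq_norm_sq, Complex.normSq_apply]
    ring
  have hsum : ∑ a, ∑ ν, c a ν ^ 2 = ∑ n : freqBall M, bracketSq n ^ s * ∑ ν, ‖κ n ν‖ ^ 2 := by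
    rw [Fintype.sum_prod_type]
    refine Finset.sum_congr rfl fun n _ => ?_
    rw [Fintype.sum_bool, ← Finset.sum_add_distrib, Finset.mul_sum]
    refine Finset.sum_congr rfl fun ν _ => ?_
    simp only [c, if_true, Bool.false_eq_true, if_false]
    rw [mul_pow, mul_pow, Real.sq_sqrt (hJ n), ← Complex.normSq_eq_norm_sq, Complex.normSq_apply]
    ring
  have hsys := isGaussianSystem_gff hs M
  refine eLpNorm_le_of_integral_pow_le q ?_ ?_ ?_
  · exact mul_nonneg (by positivity) (Finset.sum_nonneg fun n _ =>
      mul_nonneg (hJ n) (by positivity))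
  · have h1 := hsys.integrable ((∑ a, wick (tensorPoly (c a)) ^ 2) ^ (q + 1))
    simp only [map_pow, map_sum] at h1
    simpa only [hnorm] using h1
  · simp_rw [hnorm]
    rw [← hsum]
    exact hsys.integral_pow_wick_tensorPoly_le k q c

lemma memLp_F {m : ℕ} (hm : 1 ≤ m) {s : ℝ} (hs : s < 0) (N : ℕ) {p : ℝ≥0∞} (hp : p ≠ ∞) :
    MemLp (fun u : Hs s => F m N u) p (gff s) := by
  obtain ⟨q, hq⟩ := ENNReal.exists_nat_gt hp
  have h1 : MemLp (fun u : Hs s => F m N u) ((2 * (q + 1) : ℕ) : ℝ≥0∞) (gff s) := by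
    refine ⟨(continuous_F hm N).aestronglyMeasurable, ?_⟩
    refine (eLpNorm_le_of_coeff_eq_wickVal hs _ (kernelCoeff N N (2 * (m - 1) + 1))
      (fun u n _ => ?_) (fun u n hn => ?_) q).trans_lt ENNReal.ofReal_lt_top
    · rw [F_apply, nonlinCoeff_eq_wickVal hm le_rfl]
    · rw [F_apply]; simp [nonlinCoeff, hn]
  refine h1.mono_exponent (hq.le.trans ?_)
  exact_mod_cast (by omega : q ≤ 2 * (q + 1))

lemma exists_eLpNorm_F_sub_le {m : ℕ} (hm : 1 ≤ m) {s ε : ℝ} (hε : 0 < ε) (hε1 : ε < 1)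
    (hsε : s + ε < 0) :
    ∃ C : ℝ, 0 < C ∧ ∀ p : ℝ, ∀ M N : ℕ, 1 ≤ N → N ≤ M →
      eLpNorm (fun u : Hs s => F m M u - F m N u) (ENNReal.ofReal p) (gff s) ≤
        ENNReal.ofReal (C * (max p 2 - 1) ^ ((m : ℝ) - 1 / 2) * (1 / (N : ℝ) ^ ε)) := by
  set k := 2 * (m - 1) + 1 with hk
  obtain ⟨C₀, hC₀, h₀⟩ := exists_sum_kernelCoeff_sub_le hε hε1 hsε (k := k) (by omega)
  refine ⟨Real.sqrt (3 ^ k * k.factorial * C₀), by positivity, fun p M N hN hNM => ?_⟩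
  set P := max p 2
  have hP2 : 2 ≤ P := le_max_right _ _
  have hpP : p ≤ P := le_max_left _ _
  -- This choice gives p ≤ P ≤ 2(q + 1), while 2q + 1 ≤ P + 1 ≤ 3(P - 1) because P ≥ 2; hence the
  -- 3^k in the constant.
  set q := ⌊P / 2⌋₊ with hq
  have hq1 : (q : ℝ) ≤ P / 2 := Nat.floor_le (by linarith)
  have hq2 : P / 2 < q + 1 := Nat.lt_floor_add_one _
  have hs : s < 0 := by linarith
  have hle : ENNReal.ofReal p ≤ ((2 * (q + 1) : ℕ) : ℝ≥0∞) := by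
    rw [← ENNReal.ofReal_natCast]
    refine ENNReal.ofReal_le_ofReal ?_
    push_cast
    linarith
  refine (eLpNorm_le_eLpNorm_of_exponent_le hle
    ((continuous_F hm M).sub (continuous_F hm N)).aestronglyMeasurable).trans ?_
  refine (eLpNorm_le_of_coeff_eq_wickVal hs (fun u => F m M u - F m N u)
    (fun n => kernelCoeff M M k n - kernelCoeff M N k n) (fun u n _ => ?_) (fun u n hn => ?_)
    q).trans (ENNReal.ofReal_le_ofReal ?_)
  · rw [sub_apply_Hs, F_apply, F_apply, nonlinCoeff_eq_wickVal hm le_rfl,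
      nonlinCoeff_eq_wickVal hm hNM, wickVal_sub]
  · have hn' : n ∉ freqBall N := fun h => hn (freqBall_mono hNM h)
    rw [sub_apply_Hs, F_apply, F_apply]
    simp [nonlinCoeff, hn, hn']
  · set r := 1 / (N : ℝ) ^ ε
    have hr : 0 ≤ r := by positivity
    have hP1 : 0 < P - 1 := by linarith
    have hpow : ((P - 1) ^ ((m : ℝ) - 1 / 2)) ^ 2 = (P - 1) ^ k := by
      rw [← Real.rpow_natCast, ← Real.rpow_natCast (P - 1) k, ← Real.rpow_mul hP1.le]
      congr 1
      rw [hk]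
      push_cast [Nat.cast_sub hm]
      ring
    refine Real.sqrt_le_iff.2 ⟨by positivity, ?_⟩
    rw [mul_pow, mul_pow, Real.sq_sqrt (by positivity), hpow]
    have h1 := h₀ M N hN hNM
    have h2 : (2 * q + 1 : ℝ) ^ k ≤ 3 ^ k * (P - 1) ^ k := by
      rw [← mul_pow]
      exact pow_le_pow_left₀ (by positivity) (by linarith) _
    calc (2 * q + 1 : ℝ) ^ k * k.factorial * _
        ≤ (3 ^ k * (P - 1) ^ k) * k.factorial * (C₀ * r ^ 2) := by
          refine mul_le_mul (mul_le_mul_of_nonneg_right h2 (by positivity)) h1 ?_ (by positivity)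
          exact Finset.sum_nonneg fun n _ =>
            mul_nonneg (Real.rpow_pos_of_pos (bracketSq_pos _) _).le (by positivity)
      _ = _ := by ring

end MomentBounds

end WickNLS

end

/-! ### Convergence and rate -/

theorem proposition1p3 (m : ℕ) (hm : 2 ≤ m) (s : ℝ) (hs : s < 0) :
    (∀ (p : ℝ≥0∞) [Fact (1 ≤ p)], p ≠ ∞ →
      ∃ hF : ∀ N : ℕ, MemLp (fun u : WickNLS.Hs s => WickNLS.F m N u) p (WickNLS.gff s),
        CauchySeq fun N : ℕ => (hF N).toLp (fun u : WickNLS.Hs s => WickNLS.F m N u)) ∧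
    ∀ ε : ℝ, 0 < ε → ε < 1 → s + ε < 0 →
      ∃ C : ℝ, 0 < C ∧ ∀ p : ℝ, 1 ≤ p → ∀ M N : ℕ, 1 ≤ N → N ≤ M →
        eLpNorm (fun u : WickNLS.Hs s => WickNLS.F m M u - WickNLS.F m N u)
            (ENNReal.ofReal p) (WickNLS.gff s) ≤
          ENNReal.ofReal (C * (max p 2 - 1) ^ ((m : ℝ) - 1 / 2) * (1 / (N : ℝ) ^ ε)) := by
  have hm1 : 1 ≤ m := by omega
  refine ⟨fun p _ hp => ⟨fun N => WickNLS.memLp_F hm1 hs N hp, ?_⟩, fun ε hε hε1 hsε => ?_⟩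
  -- Any admissible ε yields the Cauchy property; halving makes both ε < 1 and s + ε < 0 strict.
  · set ε := min (-s) 1 / 2 with hεdef
    have h0 : 0 < min (-s) 1 := lt_min (by linarith) one_pos
    have hε : 0 < ε := by positivity
    have hε1 : ε < 1 := by linarith [min_le_right (-s) 1]
    have hsε : s + ε < 0 := by linarith [min_le_left (-s) 1]
    obtain ⟨C, hC, h⟩ := WickNLS.exists_eLpNorm_F_sub_le hm1 hε hε1 hsε
    set K := C * (max p.toReal 2 - 1) ^ ((m : ℝ) - 1 / 2)
    have hlim : Filter.Tendsto (fun N : ℕ => K * (1 / (N : ℝ) ^ ε)) Filter.atTop (nhds 0) := by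
      have h1 := (tendsto_rpow_neg_atTop hε).comp tendsto_natCast_atTop_atTop (α := ℕ)
      have h2 := h1.const_mul K
      rw [mul_zero] at h2
      refine h2.congr fun N => ?_
      simp only [Function.comp, one_div]
      rw [Real.rpow_neg (by positivity)]
    refine Metric.cauchySeq_iff'.2 fun η hη => ?_
    obtain ⟨N, hN1, hN⟩ :=
      ((Filter.eventually_ge_atTop 1).and (hlim.eventually (gt_mem_nhds hη))).exists
    refine ⟨N, fun M hM => ?_⟩
    have h1 := h p.toReal M N hN1 hM
    rw [ENNReal.ofReal_toReal hp] at h1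
    rw [← edist_lt_ofReal, Lp.edist_toLp_toLp]
    exact h1.trans_lt ((ENNReal.ofReal_lt_ofReal_iff hη).2 hN)
  · obtain ⟨C, hC, h⟩ := WickNLS.exists_eLpNorm_F_sub_le hm1 hε hε1 hsε
    exact ⟨C, hC, fun p _ => h p⟩
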